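/- Let $(\Omega,\Sigma,\mu)$ be a measure space and $X\neq\{0\}$ a real Banach space. Let $L_1(\mu;X)$ be the Lebesgue–Bochner space of (classes of) strongly measurable, Bochner integrable functions $\Omega\to X$. Suppose that at least one of the following holds: 1. $\mu$ is decomposable and $X^*$ is separable; 2. $\mu$ is $\sigma$-finite and $X^*$ has the Radon–Nikodým property with respect to $\mu$; 3. $L_1(\mu;X)^*=L_\infty(\mu;X^*)$, where $L_\infty(\mu;X^*)$ is the space of (classes of) essentially bounded strongly measurable functions $\Omega\to X^*$, i.e. there is a surjective linear isometry $\Phi\colon L_\infty(\mu;X^*)\to L_1(\mu;X)^*$ with $\Phi(g)(f)=\int_\Omega g(\omega)(f(\omega))\,d\mu(\omega)$. Then: (a) If $\mu\ne0$ is atomless, then $L_1(\mu;X)$ has the 1-ASD2P$_\omega$. (b) If $\mu$ has atoms, then for each of the properties $P\in\{$SD2P, ASD2P, 1-ASD2P$_{<\omega}$, SD2P$_\omega$, 1-ASD2P$_\omega\}$, the space $L_1(\mu;X)$ has $P$ if and only if $X$ has $P$. Here the notions are as follows. $\mu$ is *decomposable* if $\Omega$ is partitioned into a family $(\Omega_i)_{i\in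 I}$ of measurable sets of finite measure such that a set $E\subset\Omega$ is measurable as soon as all $E\cap\Omega_i$ are, and $\mu(E)=\sum_i\mu(E\cap\Omega_i)$ for every $E\in\Sigma$. An *atom* of $\mu$ is a set $A\in\Sigma$ with $\mu(A)>0$ such that each measurable $B\subset A$ satisfies $\mu(B)=0$ or $\mu(A\setminus B)=0$; $\mu$ is *atomless* if it has no atoms. A Banach space $Y$ has the *Radon–Nikodým property with respect to* $\mu$ if for every countably additive $G\colon\Sigma\to Y$ of bounded variation vanishing on $\mu$-null sets there is a Bochner integrable $g\colon\Omega\to Y$ with $G(E)=\int_E g\,d\mu$ for all $E\in\Sigma$. For a normed space $Z$ with closed unit ball $B_Z$ and unit sphere $S_Z$, a *slice* of $B_Z$ is a set $\{z\in B_Z: z^*(z)\ge 1-\varepsilon\}$ with $z^*\in S_{Z^*}$, $\varepsilon\in(0,1)$. $Z$ has the *SD2P* if every finite convex combination of slices of $B_Z$ meets $B_Z\setminus rB_Z$ for every $r\in(0,1)$, and the *ASD2P* if every finite convex combination of slices of $B_Z$ meets $S_Z$. A set $B\subset Z$ *$r$-norms* $A\subset Z^*$ if for every $z^*\in A$ there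 is $z\in B\setminus\{0\}$ with $z^*(z)\ge r\|z\|\|z^*\|$, and it *norms* $A$ if it $r$-norms $A$ for all $r\in(0,1)$. $Z$ has the *SD2P$_\omega$* if for every countable $A\subset S_{Z^*}$ and every $r\in(0,1)$ there are $B\subset S_Z$ and $z^*\in S_{Z^*}$ such that $B$ $r$-norms $A$ and $z^*(z)\ge r$ for all $z\in B$. $Z$ has the *1-ASD2P$_\omega$* (respectively *1-ASD2P$_{<\omega}$*) if for every countable (respectively finite) $A\subset S_{Z^*}$ there are $B\subset S_Z$ and $z^*\in S_{Z^*}$ such that $B$ norms $A$ and $z^*(z)=1$ for all $z\in B$. -/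

import Mathlib

open Set MeasureTheory
open scoped ENNReal Cardinal

noncomputable section

/-! ### Slices and the diameter two properties of a real normed space -/

section DiameterTwo

universe u

variable {E : Type u} [NormedAddCommGroup E] [NormedSpace ℝ E]

/-- The set `{x ∈ B_E : f x ≥ 1 - ε}`; it is a slice of the unit ball when `‖f‖ = 1` and
`0 < ε < 1`. -/
def ballSlice (f : StrongDual ℝ E) (ε : ℝ) : Set E :=
  {x | x ∈ Metric.closedBall (0 : E) 1 ∧ 1 - ε ≤ f x}

/-- `S` is a slice of the closed unit ball of `E`. -/
def IsBallSlice (S : Set E) : Prop :=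
  ∃ (f : StrongDual ℝ E) (ε : ℝ), ‖f‖ = 1 ∧ 0 < ε ∧ ε < 1 ∧ S = ballSlice f ε

/-- `C` is a finite convex combination `∑ i, c i • S i` (Minkowski sum) of slices of the closed
unit ball of `E`. -/
def IsConvexCombinationOfSlices (C : Set E) : Prop :=
  ∃ (n : ℕ) (S : Fin n → Set E) (c : Fin n → ℝ),
    (∀ i, IsBallSlice (S i)) ∧ (∀ i, 0 ≤ c i) ∧ ∑ i, c i = 1 ∧
      C = {z | ∃ x : Fin n → E, (∀ i, x i ∈ S i) ∧ z = ∑ i, c i • x i}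

variable (E)

/-- The strong diameter two property (SD2P): every finite convex combination of slices of `B_E`
intersects `B_E \ r B_E` for every `r ∈ (0,1)`. -/
def HasSD2P : Prop :=
  ∀ C : Set E, IsConvexCombinationOfSlices C → ∀ r : ℝ, 0 < r → r < 1 →
    (C ∩ (Metric.closedBall (0 : E) 1 \ Metric.closedBall (0 : E) r)).Nonempty

/-- The attaining strong diameter two property (ASD2P): every finite convex combination of slices
of `B_E` intersects the unit sphere. -/
def HasASD2P : Prop :=
  ∀ C : Set E, IsConvexCombinationOfSlices C → (C ∩ Metric.sphere (0 : E) 1).Nonempty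

variable {E}

/-- `B ⊆ E` `r`-norms the set of functionals `A ⊆ E*`. -/
def NormsWith (r : ℝ) (B : Set E) (A : Set (StrongDual ℝ E)) : Prop :=
  ∀ y ∈ A, ∃ x ∈ B, x ≠ 0 ∧ r * ‖x‖ * ‖y‖ ≤ y x

/-- `B ⊆ E` norms the set of functionals `A ⊆ E*`: it `r`-norms `A` for every `r ∈ (0,1)`. -/
def Norms (B : Set E) (A : Set (StrongDual ℝ E)) : Prop :=
  ∀ r : ℝ, 0 < r → r < 1 → NormsWith r B A

/-- The condition in the definition of the SD2P with respect to a cardinal, for one set `A` of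
norm one functionals. -/
def SD2PAt (A : Set (StrongDual ℝ E)) : Prop :=
  ∀ r : ℝ, 0 < r → r < 1 →
    ∃ (B : Set E) (f : StrongDual ℝ E), B ⊆ Metric.sphere (0 : E) 1 ∧ ‖f‖ = 1 ∧
      NormsWith r B A ∧ ∀ x ∈ B, r ≤ f x

/-- The condition in the definition of the 1-ASD2P with respect to a cardinal, for one set `A` of
norm one functionals. -/
def OneASD2PAt (A : Set (StrongDual ℝ E)) : Prop :=
  ∃ (B : Set E) (f : StrongDual ℝ E), B ⊆ Metric.sphere (0 : E) 1 ∧ ‖f‖ = 1 ∧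
    Norms B A ∧ ∀ x ∈ B, f x = 1

variable (E)

/-- The strong diameter two property with respect to `κ` (SD2P_κ). -/
def HasSD2PCard (κ : Cardinal.{u}) : Prop :=
  ∀ A : Set (StrongDual ℝ E), A ⊆ Metric.sphere 0 1 → #A ≤ κ → SD2PAt A

/-- The 1-norming attaining strong diameter two property with respect to `κ` (1-ASD2P_κ). -/
def HasOneASD2PCard (κ : Cardinal.{u}) : Prop :=
  ∀ A : Set (StrongDual ℝ E), A ⊆ Metric.sphere 0 1 → #A ≤ κ → OneASD2PAt A

/-- The property 1-ASD2P_{<κ}: as 1-ASD2P_κ, for sets of cardinality strictly less than `κ`. -/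
def HasOneASD2PCardLT (κ : Cardinal.{u}) : Prop :=
  ∀ A : Set (StrongDual ℝ E), A ⊆ Metric.sphere 0 1 → #A < κ → OneASD2PAt A

end DiameterTwo

/-! ### Measure theory -/

section MeasureNotions

variable {Ω : Type*} [MeasurableSpace Ω]

/-- `A` is an atom of `μ`. -/
def IsMeasureAtom (μ : Measure Ω) (A : Set Ω) : Prop :=
  MeasurableSet A ∧ μ A ≠ 0 ∧
    ∀ B : Set Ω, MeasurableSet B → B ⊆ A → μ B = 0 ∨ μ (A \ B) = 0

/-- `μ` has at least one atom. -/
def HasAtoms (μ : Measure Ω) : Prop := ∃ A, IsMeasureAtom μ A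

/-- `μ` has no atoms. (This is not Mathlib's class `NoAtoms`, which only speaks of singletons.) -/
def IsAtomless (μ : Measure Ω) : Prop := ¬ HasAtoms μ

/-- `μ` is decomposable (strictly localizable): `Ω` is partitioned into measurable sets of finite
measure such that measurability and the measure of a set are determined by its traces on the
pieces. -/
def IsDecomposable (μ : Measure Ω) : Prop :=
  ∃ F : Set (Set Ω), F.PairwiseDisjoint id ∧ ⋃₀ F = univ ∧
    (∀ D ∈ F, MeasurableSet D ∧ μ D < ∞) ∧
    (∀ s : Set Ω, (∀ D ∈ F, MeasurableSet (s ∩ D)) → MeasurableSet s) ∧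
    ∀ s : Set Ω, MeasurableSet s → μ s = ∑' D : F, μ (s ∩ D)

/-- `Y` has the Radon–Nikodým property with respect to `μ`: every countably additive `Y`-valued
measure of bounded variation which vanishes on the `μ`-null sets is the indefinite Bochner
integral of a `μ`-integrable function. -/
def HasRNPWithRespectTo (Y : Type*) [NormedAddCommGroup Y] [NormedSpace ℝ Y]
    (μ : Measure Ω) : Prop :=
  ∀ G : VectorMeasure Ω Y, (∀ s, MeasurableSet s → μ s = 0 → G s = 0) →
    G.variation univ < ∞ →
    ∃ g : Ω → Y, Integrable g μ ∧ ∀ s, MeasurableSet s → G s = ∫ ω in s, g ω ∂μ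

/-- `L_1(μ;X)* = L_∞(μ;X*)`: the pairing `⟨g, f⟩ = ∫ g(ω)(f(ω)) dμ(ω)` identifies `L_∞(μ;X*)`
isometrically with the dual of `L_1(μ;X)`. -/
def DualOfL1IsLinfty (X : Type*) [NormedAddCommGroup X] [NormedSpace ℝ X]
    (μ : Measure Ω) : Prop :=
  ∃ Φ : Lp (StrongDual ℝ X) ∞ μ ≃ₗᵢ[ℝ] StrongDual ℝ (Lp X 1 μ),
    ∀ (g : Lp (StrongDual ℝ X) ∞ μ) (f : Lp X 1 μ), Φ g f = ∫ ω, (g ω) (f ω) ∂μ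

end MeasureNotions

end

/-!
The five properties are brought to a common form: for every family `φ` of norm one functionals
(indexed by `Fin n` or `ℕ`) there are a functional `f` in the dual unit ball and, for every `i` and
every norming constant `r ∈ R`, a unit vector `x` with `r ≤ φ i x` and `t ≤ f x`. Taking `R = {r}`
or `R = (0,1)`, and `t = r` or `t = 1`, gives all of them; for the properties defined by slices this
uses a functional norming the arithmetic mean of points of the slices.

No description of the dual of `L_1(μ;X)` is needed. A functional on `L_1(μ;X)` of norm greater than
`s` satisfies `s μ(F) ≤ φ (1_F x)` for some unit vector `x` and all measurable subsets `F` of some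
set `E` of positive finite measure (`exists_forall_subset_le`: density of simple functions, then a
Hahn decomposition), and `E` may be taken to be an atom or free of atoms. For countably many
functionals the sets `E` can be shrunk so that any two are almost disjoint or are almost equal atoms
(`exists_refinement`). On a set free of atoms one functional norming the vector `x` is enough. On an
atom the property of `X` is applied to the restrictions of the `φ i`, which are functionals on `X`.
The functionals on `X` obtained piece by piece are glued to one functional on `L_1(μ;X)`
(`exists_functional_glue`). This shows that `L_1(μ;X)` inherits the property from `X`, and that
nothing is required of `X` if there are no atoms (`hasAlignedNorming_L1`).

Conversely, strongly measurable functions are almost everywhere constant on an atom, so an atom of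
finite measure makes `X` an `L`-summand of `L_1(μ;X)` (`IsMeasureAtom.norm_sub_average`), and the
property passes to such summands (`hasAlignedNorming_of_L1`).

Each of the three alternative hypotheses enters through one consequence: sets of positive measure
contain sets of finite positive measure. Hence atoms have finite measure, and `L_1(μ;X)` is not
zero.
-/

/-! ### The diameter two properties in terms of families of functionals -/

section Families

variable {E : Type*} [NormedAddCommGroup E] [NormedSpace ℝ E]

/-- Some functional `f` in the unit ball of the dual satisfies: for every `i` and every `r ∈ R`
there is a unit vector `x` with `r ≤ φ i x` and `t ≤ f x`. The set `B` of the diameter two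
properties is left implicit: it can be taken to be the set of all unit vectors with `t ≤ f x`. -/
def AlignedNorming {ι : Type*} (φ : ι → StrongDual ℝ E) (R : Set ℝ) (t : ℝ) : Prop :=
  ∃ f : StrongDual ℝ E, ‖f‖ ≤ 1 ∧ ∀ i, ∀ r ∈ R, ∃ x : E, ‖x‖ = 1 ∧ r ≤ φ i x ∧ t ≤ f x

variable (E) in
/-- Every family of norm one functionals indexed by `ι` satisfies `AlignedNorming` with
parameters `R` and `t`. -/
def HasAlignedNorming (ι : Type) (R : Set ℝ) (t : ℝ) : Prop :=
  ∀ φ : ι → StrongDual ℝ E, (∀ i, ‖φ i‖ = 1) → AlignedNorming φ R t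

theorem apply_le_one {f : StrongDual ℝ E} {x : E} (hf : ‖f‖ ≤ 1) (hx : ‖x‖ ≤ 1) : f x ≤ 1 :=
  (le_abs_self _).trans ((f.le_opNorm x).trans (mul_le_one₀ hf (norm_nonneg x) hx))

theorem exists_unit_functional [Nontrivial E] : ∃ f : StrongDual ℝ E, ‖f‖ = 1 :=
  let ⟨f, hf, _⟩ := exists_dual_vector' ℝ (0 : E)
  ⟨f, hf⟩

theorem AlignedNorming.mono {ι : Type*} {φ : ι → StrongDual ℝ E} {R R' : Set ℝ} {t : ℝ}
    (h : AlignedNorming φ R' t) (hR : ∀ r ∈ R, ∃ r' ∈ R', r ≤ r') : AlignedNorming φ R t := by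
  obtain ⟨f, hf, h⟩ := h
  refine ⟨f, hf, fun i r hr => ?_⟩
  obtain ⟨r', hr', hle⟩ := hR r hr
  obtain ⟨x, hx, h1, h2⟩ := h i r' hr'
  exact ⟨x, hx, hle.trans h1, h2⟩

theorem alignedNorming_range {ι : Type*} {φ : ι → StrongDual ℝ E} {R : Set ℝ} {t : ℝ} :
    AlignedNorming (fun y : range φ => (y : StrongDual ℝ E)) R t ↔ AlignedNorming φ R t := by
  constructor
  · rintro ⟨f, hf, h⟩
    exact ⟨f, hf, fun i => h ⟨φ i, i, rfl⟩⟩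
  · rintro ⟨f, hf, h⟩
    refine ⟨f, hf, ?_⟩
    rintro ⟨_, i, rfl⟩
    exact h i

theorem AlignedNorming.exists_norm_eq_one [Nontrivial E] {ι : Type*} {φ : ι → StrongDual ℝ E}
    {R : Set ℝ} {t : ℝ} (ht : 0 < t) (h : AlignedNorming φ R t) :
    ∃ f : StrongDual ℝ E, ‖f‖ = 1 ∧
      ∀ i, ∀ r ∈ R, ∃ x : E, ‖x‖ = 1 ∧ r ≤ φ i x ∧ t ≤ f x := by
  obtain ⟨f, hf, h⟩ := h
  by_cases hf0 : f = 0
  · -- then no unit vector satisfies `t ≤ f x`, so there is nothing to norm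
    obtain ⟨g, hg⟩ := exists_unit_functional (E := E)
    refine ⟨g, hg, fun i r hr => ?_⟩
    obtain ⟨x, -, -, h2⟩ := h i r hr
    simp [hf0] at h2
    exact absurd h2 (not_le.2 ht)
  · have hpos : 0 < ‖f‖ := norm_pos_iff.2 hf0
    refine ⟨‖f‖⁻¹ • f, by simp [norm_smul, hpos.ne'], fun i r hr => ?_⟩
    obtain ⟨x, hx, h1, h2⟩ := h i r hr
    refine ⟨x, hx, h1, h2.trans ?_⟩
    have : 1 ≤ ‖f‖⁻¹ := (one_le_inv₀ hpos).2 hf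
    simpa using le_mul_of_one_le_left (ht.le.trans h2) this

theorem normsWith_of_unit {r : ℝ} {B : Set E} {A : Set (StrongDual ℝ E)}
    (hA : A ⊆ Metric.sphere 0 1) (h : ∀ y ∈ A, ∃ x ∈ B, ‖x‖ = 1 ∧ r ≤ y x) :
    NormsWith r B A := by
  intro y hy
  obtain ⟨x, hxB, hx, hr⟩ := h y hy
  have hy1 : ‖y‖ = 1 := by simpa using hA hy
  exact ⟨x, hxB, fun h0 => by simp [h0] at hx, by simpa [hx, hy1] using hr⟩

theorem NormsWith.exists_unit {r : ℝ} {B : Set E} {A : Set (StrongDual ℝ E)}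
    (hA : A ⊆ Metric.sphere 0 1) (hB : B ⊆ Metric.sphere 0 1) (h : NormsWith r B A) :
    ∀ y ∈ A, ∃ x ∈ B, ‖x‖ = 1 ∧ r ≤ y x := by
  intro y hy
  obtain ⟨x, hxB, -, hr⟩ := h y hy
  have hy1 : ‖y‖ = 1 := by simpa using hA hy
  have hx1 : ‖x‖ = 1 := by simpa using hB hxB
  exact ⟨x, hxB, hx1, by simpa [hx1, hy1] using hr⟩

theorem oneASD2PAt_iff [Nontrivial E] {A : Set (StrongDual ℝ E)} (hA : A ⊆ Metric.sphere 0 1) :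
    OneASD2PAt A ↔ AlignedNorming (fun y : A => (y : StrongDual ℝ E)) (Ioo 0 1) 1 := by
  constructor
  · rintro ⟨B, f, hB, hf, hN, h1⟩
    refine ⟨f, hf.le, fun y r hr => ?_⟩
    obtain ⟨x, hxB, hx, hxr⟩ := (hN r hr.1 hr.2).exists_unit hA hB y y.2
    exact ⟨x, hx, hxr, (h1 x hxB).ge⟩
  · intro h
    obtain ⟨f, hf, h⟩ := h.exists_norm_eq_one one_pos
    refine ⟨{x | ‖x‖ = 1 ∧ f x = 1}, f, fun x hx => by simpa using hx.1, hf,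
      fun r h0 h1 => normsWith_of_unit hA fun y hy => ?_, fun x hx => hx.2⟩
    obtain ⟨x, hx, hxr, hfx⟩ := h ⟨y, hy⟩ r ⟨h0, h1⟩
    exact ⟨x, ⟨hx, (apply_le_one hf.le hx.le).antisymm hfx⟩, hx, hxr⟩

theorem sd2pAt_iff [Nontrivial E] {A : Set (StrongDual ℝ E)} (hA : A ⊆ Metric.sphere 0 1) :
    SD2PAt A ↔ ∀ r ∈ Ioo (0 : ℝ) 1,
      AlignedNorming (fun y : A => (y : StrongDual ℝ E)) {r} r := by
  constructor
  · rintro h r ⟨h0, h1⟩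
    obtain ⟨B, f, hB, hf, hN, hfB⟩ := h r h0 h1
    refine ⟨f, hf.le, fun y s hs => ?_⟩
    obtain rfl : s = r := hs
    obtain ⟨x, hxB, hx, hxr⟩ := hN.exists_unit hA hB y y.2
    exact ⟨x, hx, hxr, hfB x hxB⟩
  · intro h r h0 h1
    obtain ⟨f, hf, h⟩ := (h r ⟨h0, h1⟩).exists_norm_eq_one h0
    refine ⟨{x | ‖x‖ = 1 ∧ r ≤ f x}, f, fun x hx => by simpa using hx.1, hf,
      normsWith_of_unit hA fun y hy => ?_, fun x hx => hx.2⟩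
    obtain ⟨x, hx, hxr, hfx⟩ := h ⟨y, hy⟩ r rfl
    exact ⟨x, ⟨hx, hfx⟩, hx, hxr⟩

theorem forall_countable_iff {R : Set ℝ} {t : ℝ} :
    (∀ A : Set (StrongDual ℝ E), A ⊆ Metric.sphere 0 1 → #A ≤ ℵ₀ →
      AlignedNorming (fun y : A => (y : StrongDual ℝ E)) R t) ↔ HasAlignedNorming E ℕ R t := by
  constructor
  · intro h φ hφ
    refine alignedNorming_range.1 (h (range φ) ?_ (countable_range φ).le_aleph0)
    rintro _ ⟨i, rfl⟩
    simpa using hφ i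
  · intro h A hA hc
    rcases A.eq_empty_or_nonempty with rfl | hne
    · exact ⟨0, by simp, fun y => absurd y.2 (notMem_empty _)⟩
    · obtain ⟨φ, rfl⟩ := (Cardinal.le_aleph0_iff_set_countable.1 hc).exists_eq_range hne
      exact alignedNorming_range.2 (h φ fun i => by simpa using hA ⟨i, rfl⟩)

theorem forall_finite_iff {R : Set ℝ} {t : ℝ} :
    (∀ A : Set (StrongDual ℝ E), A ⊆ Metric.sphere 0 1 → #A < ℵ₀ →
      AlignedNorming (fun y : A => (y : StrongDual ℝ E)) R t) ↔
      ∀ n, HasAlignedNorming E (Fin n) R t := by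
  constructor
  · intro h n φ hφ
    refine alignedNorming_range.1 (h (range φ) ?_ (finite_range φ).lt_aleph0)
    rintro _ ⟨i, rfl⟩
    simpa using hφ i
  · intro h A hA hc
    obtain ⟨n, φ, -, rfl⟩ := (Cardinal.lt_aleph0_iff_set_finite.1 hc).fin_param
    exact alignedNorming_range.2 (h n φ fun i => by simpa using hA ⟨i, rfl⟩)

theorem hasOneASD2PCard_iff [Nontrivial E] :
    HasOneASD2PCard E ℵ₀ ↔ HasAlignedNorming E ℕ (Ioo 0 1) 1 := by
  rw [← forall_countable_iff]
  exact forall_congr' fun A => forall_congr' fun hA => forall_congr' fun _ => oneASD2PAt_iff hA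

theorem hasOneASD2PCardLT_iff [Nontrivial E] :
    HasOneASD2PCardLT E ℵ₀ ↔ ∀ n, HasAlignedNorming E (Fin n) (Ioo 0 1) 1 := by
  rw [← forall_finite_iff]
  exact forall_congr' fun A => forall_congr' fun hA => forall_congr' fun _ => oneASD2PAt_iff hA

theorem hasSD2PCard_iff [Nontrivial E] :
    HasSD2PCard E ℵ₀ ↔ ∀ r ∈ Ioo (0 : ℝ) 1, HasAlignedNorming E ℕ {r} r := by
  simp_rw [← forall_countable_iff]
  constructor
  · exact fun h r hr A hA hc => (sd2pAt_iff hA).1 (h A hA hc) r hr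
  · exact fun h A hA hc => (sd2pAt_iff hA).2 fun r hr => h r hr A hA hc

/-- If the arithmetic mean of points of the slices given by the `φ i` has norm at least `s`, a
functional norming the mean is at least `1 - n * (1 - s)` on each of the points. -/
theorem alignedNorming_of_average {n : ℕ} {φ : Fin n → StrongDual ℝ E} {r s t : ℝ} (hr : 0 < r)
    (ht : 0 < t) {x : Fin n → E} (hx : ∀ i, x i ∈ ballSlice (φ i) (1 - r))
    (hs : s ≤ ‖∑ i, (n : ℝ)⁻¹ • x i‖) (hst : t ≤ 1 - n * (1 - s)) : AlignedNorming φ {r} t := by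
  obtain ⟨f, hf, hfz⟩ := exists_dual_vector'' ℝ (∑ i, (n : ℝ)⁻¹ • x i)
  refine ⟨f, hf, fun j q hq => ?_⟩
  obtain rfl : q = r := hq
  have hn : (0 : ℝ) < n := by exact_mod_cast j.pos
  have hx1 : ∀ i, ‖x i‖ ≤ 1 := fun i => by simpa using (hx i).1
  have hle : ∀ i, f (x i) ≤ 1 := fun i => apply_le_one hf (hx1 i)
  have hsum : n * s ≤ ∑ i, f (x i) := by
    have h1 : ∑ i, (n : ℝ)⁻¹ * f (x i) = ‖∑ i, (n : ℝ)⁻¹ • x i‖ := by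
      have h2 : f (∑ i, (n : ℝ)⁻¹ • x i) = ‖∑ i, (n : ℝ)⁻¹ • x i‖ := hfz
      rw [← h2]
      simp [map_sum]
    rw [← Finset.mul_sum] at h1
    have h2 : s ≤ (n : ℝ)⁻¹ * ∑ i, f (x i) := hs.trans h1.ge
    calc n * s ≤ n * ((n : ℝ)⁻¹ * ∑ i, f (x i)) := by gcongr
      _ = ∑ i, f (x i) := by rw [mul_inv_cancel_left₀ hn.ne']
  have hfj : t ≤ f (x j) := by
    have h1 : 1 - f (x j) ≤ ∑ i, (1 - f (x i)) :=
      Finset.single_le_sum (f := fun i => 1 - f (x i)) (fun i _ => sub_nonneg.2 (hle i))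
        (Finset.mem_univ j)
    simp only [Finset.sum_sub_distrib, Finset.sum_const, Finset.card_univ, Fintype.card_fin,
      nsmul_eq_mul, mul_one] at h1
    nlinarith
  have hφj : q ≤ φ j (x j) := by linarith [(hx j).2]
  have hne : x j ≠ 0 := fun h0 => by simp [h0] at hfj; linarith
  have hpos : 0 < ‖x j‖ := norm_pos_iff.2 hne
  have hinv : 1 ≤ ‖x j‖⁻¹ := (one_le_inv₀ hpos).2 (hx1 j)
  refine ⟨‖x j‖⁻¹ • x j, by simp [norm_smul, hpos.ne'], ?_, ?_⟩
  · simpa using hφj.trans (le_mul_of_one_le_left (hr.le.trans hφj) hinv)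
  · simpa using hfj.trans (le_mul_of_one_le_left (ht.le.trans hfj) hinv)

theorem isConvexCombinationOfSlices_average {n : ℕ} (hn : n ≠ 0) {φ : Fin n → StrongDual ℝ E}
    (hφ : ∀ i, ‖φ i‖ = 1) {r : ℝ} (hr : r ∈ Ioo (0 : ℝ) 1) :
    IsConvexCombinationOfSlices {z | ∃ x : Fin n → E,
      (∀ i, x i ∈ ballSlice (φ i) (1 - r)) ∧ z = ∑ i, (n : ℝ)⁻¹ • x i} :=
  ⟨n, fun i => ballSlice (φ i) (1 - r), fun _ => (n : ℝ)⁻¹,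
    fun i => ⟨φ i, 1 - r, hφ i, by linarith [hr.2], by linarith [hr.1], rfl⟩,
    fun _ => by positivity, by simp [hn], rfl⟩

theorem exists_mem_convexCombination {n : ℕ} {φ : Fin n → StrongDual ℝ E} {ε c : Fin n → ℝ}
    {r t : ℝ} (hr : ∀ i, 1 - ε i ≤ r) (hc : ∀ i, 0 ≤ c i) (hc1 : ∑ i, c i = 1)
    (h : AlignedNorming φ {r} t) :
    ∃ x : Fin n → E, (∀ i, x i ∈ ballSlice (φ i) (ε i)) ∧
      ‖∑ i, c i • x i‖ ≤ 1 ∧ t ≤ ‖∑ i, c i • x i‖ := by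
  obtain ⟨f, hf, h⟩ := h
  choose x hx hφ hfx using fun i => h i r rfl
  refine ⟨x, fun i => ⟨by simpa using (hx i).le, (hr i).trans (hφ i)⟩, ?_, ?_⟩
  · calc ‖∑ i, c i • x i‖ ≤ ∑ i, ‖c i • x i‖ := norm_sum_le _ _
      _ = ∑ i, c i := by simp [norm_smul, hx, abs_of_nonneg, hc]
      _ ≤ 1 := hc1.le
  · calc t = ∑ i, c i * t := by rw [← Finset.sum_mul, hc1, one_mul]
      _ ≤ ∑ i, c i * f (x i) := Finset.sum_le_sum fun i _ => by gcongr; exacts [hc i, hfx i]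
      _ = f (∑ i, c i • x i) := by simp [map_sum]
      _ ≤ ‖f (∑ i, c i • x i)‖ := le_abs_self _
      _ ≤ ‖f‖ * ‖∑ i, c i • x i‖ := f.le_opNorm _
      _ ≤ ‖∑ i, c i • x i‖ := mul_le_of_le_one_left (norm_nonneg _) hf

theorem hasAlignedNorming_fin_zero (R : Set ℝ) (t : ℝ) : HasAlignedNorming E (Fin 0) R t :=
  fun _ _ => ⟨0, by simp, fun i => i.elim0⟩

theorem hasSD2P_iff :
    HasSD2P E ↔ ∀ n, ∀ r ∈ Ioo (0 : ℝ) 1, HasAlignedNorming E (Fin n) {r} r := by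
  constructor
  · intro h n r hr
    rcases eq_or_ne n 0 with rfl | hn
    · exact hasAlignedNorming_fin_zero _ _
    intro φ hφ
    have hn1 : (1 : ℝ) ≤ n := by exact_mod_cast Nat.one_le_iff_ne_zero.2 hn
    have hd : (1 - r) / n ≤ 1 - r := div_le_self (by linarith [hr.2]) hn1
    have hd0 : 0 < (1 - r) / n := div_pos (by linarith [hr.2]) (by linarith)
    obtain ⟨z, ⟨x, hx, rfl⟩, hz⟩ := h _ (isConvexCombinationOfSlices_average hn hφ hr)
      (1 - (1 - r) / n) (by linarith [hr.1]) (by linarith)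
    refine alignedNorming_of_average hr.1 hr.1 hx (s := 1 - (1 - r) / n) ?_ ?_
    · exact (not_le.1 fun h' => hz.2 (mem_closedBall_zero_iff.2 h')).le
    · have : (n : ℝ) * (1 - (1 - (1 - r) / n)) = 1 - r := by field_simp; ring
      linarith
  · rintro h C ⟨n, S, c, hS, hc, hc1, rfl⟩ r h0 h1
    choose φ ε hφ hε0 hε1 hSe using hS
    have hev : ∀ᶠ s in nhdsWithin (1 : ℝ) (Iio 1), r < s ∧ s < 1 ∧ ∀ i, 1 - ε i ≤ s := by
      refine .and (nhdsWithin_le_nhds (lt_mem_nhds h1)) (.and self_mem_nhdsWithin ?_)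
      refine Filter.eventually_all.2 fun i => nhdsWithin_le_nhds ?_
      exact le_mem_nhds (by linarith [hε0 i])
    obtain ⟨s, hrs, hs1, hs⟩ := hev.exists
    obtain ⟨x, hx, hz1, hz⟩ := exists_mem_convexCombination hs hc hc1
      (h n s ⟨h0.trans hrs, hs1⟩ φ hφ)
    refine ⟨_, ⟨x, fun i => hSe i ▸ hx i, rfl⟩, by simpa using hz1, ?_⟩
    simpa using hrs.trans_le hz

theorem hasASD2P_iff :
    HasASD2P E ↔ ∀ n, ∀ r ∈ Ioo (0 : ℝ) 1, HasAlignedNorming E (Fin n) {r} 1 := by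
  constructor
  · intro h n r hr
    rcases eq_or_ne n 0 with rfl | hn
    · exact hasAlignedNorming_fin_zero _ _
    intro φ hφ
    obtain ⟨z, ⟨x, hx, rfl⟩, hz⟩ := h _ (isConvexCombinationOfSlices_average hn hφ hr)
    exact alignedNorming_of_average hr.1 one_pos hx (s := 1) (by simpa using hz.ge) (by simp)
  · rintro h C ⟨n, S, c, hS, hc, hc1, rfl⟩
    choose φ ε hφ hε0 hε1 hSe using hS
    have hev : ∀ᶠ s in nhdsWithin (1 : ℝ) (Iio 1), 0 < s ∧ s < 1 ∧ ∀ i, 1 - ε i ≤ s := by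
      refine .and (nhdsWithin_le_nhds (lt_mem_nhds one_pos)) (.and self_mem_nhdsWithin ?_)
      refine Filter.eventually_all.2 fun i => nhdsWithin_le_nhds ?_
      exact le_mem_nhds (by linarith [hε0 i])
    obtain ⟨s, h0, hs1, hs⟩ := hev.exists
    obtain ⟨x, hx, hz1, hz⟩ := exists_mem_convexCombination hs hc hc1 (h n s ⟨h0, hs1⟩ φ hφ)
    exact ⟨_, ⟨x, fun i => hSe i ▸ hx i, rfl⟩, by simpa using hz1.antisymm hz⟩

end Families

/-! ### Vector multiples of indicator functions and localization of functionals -/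

section Indicators

variable {Ω : Type*} [MeasurableSpace Ω] {μ : Measure Ω}

theorem norm_toLp_add_of_disjoint {Y : Type*} [NormedAddCommGroup Y] {f g : Ω → Y}
    (hf : MemLp f 1 μ) (hg : MemLp g 1 μ)
    (h : Disjoint (Function.support f) (Function.support g)) :
    ‖hf.toLp f + hg.toLp g‖ = ‖hf.toLp f‖ + ‖hg.toLp g‖ := by
  have hfi := memLp_one_iff_integrable.1 hf
  have hgi := memLp_one_iff_integrable.1 hg
  have key : ∀ {u : Ω → Y} (hu : MemLp u 1 μ), ‖hu.toLp u‖ = ∫ ω, ‖u ω‖ ∂μ := fun hu => by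
    rw [L1.norm_eq_integral_norm]
    exact integral_congr_ae (hu.coeFn_toLp.mono fun ω hω => by simp [hω])
  rw [← MemLp.toLp_add hf hg, key, key, key, ← integral_add hfi.norm hgi.norm]
  refine integral_congr_ae (.of_forall fun ω => ?_)
  by_cases hω : f ω = 0
  · simp [hω]
  · have : g ω = 0 := by
      by_contra hgω
      exact disjoint_left.1 h hω hgω
    simp [this]

variable {X : Type*} [NormedAddCommGroup X] [NormedSpace ℝ X]

variable (μ X) in
/-- The map sending a vector `x` to the class of `ω ↦ 1_A(ω) x` in `L_1(μ;X)`. It is set to zero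
unless `A` is a measurable set of finite measure. -/
noncomputable def indicatorL1 (A : Set Ω) : X →L[ℝ] Lp X 1 μ :=
  open scoped Classical in
  if h : MeasurableSet A ∧ μ A ≠ ∞ then
    LinearMap.mkContinuous
      { toFun := fun x => indicatorConstLp 1 h.1 h.2 x
        map_add' := fun x y => by
          ext1
          filter_upwards [indicatorConstLp_coeFn (p := 1) (hs := h.1) (hμs := h.2) (c := x + y),
            indicatorConstLp_coeFn (p := 1) (hs := h.1) (hμs := h.2) (c := x),
            indicatorConstLp_coeFn (p := 1) (hs := h.1) (hμs := h.2) (c := y),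
            Lp.coeFn_add (indicatorConstLp 1 h.1 h.2 x) (indicatorConstLp 1 h.1 h.2 y)]
            with ω h1 h2 h3 h4
          rw [h1, h4, Pi.add_apply, h2, h3, indicator_add]
        map_smul' := fun a x => by
          ext1
          filter_upwards [indicatorConstLp_coeFn (p := 1) (hs := h.1) (hμs := h.2) (c := a • x),
            indicatorConstLp_coeFn (p := 1) (hs := h.1) (hμs := h.2) (c := x),
            Lp.coeFn_smul a (indicatorConstLp 1 h.1 h.2 x)] with ω h1 h2 h3
          rw [h1, RingHom.id_apply, h3, Pi.smul_apply, h2, indicator_const_smul_apply] }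
      (μ.real A) fun x => by simp [norm_indicatorConstLp, mul_comm]
  else 0

variable {A B : Set Ω}

theorem indicatorL1_eq (hA : MeasurableSet A) (hμ : μ A ≠ ∞) (x : X) :
    indicatorL1 μ X A x = indicatorConstLp 1 hA hμ x := by
  rw [indicatorL1, dif_pos ⟨hA, hμ⟩]; rfl

theorem indicatorL1_coeFn (hA : MeasurableSet A) (hμ : μ A ≠ ∞) (x : X) :
    indicatorL1 μ X A x =ᵐ[μ] A.indicator fun _ => x := by
  rw [indicatorL1_eq hA hμ]; exact indicatorConstLp_coeFn

theorem norm_indicatorL1 (hA : MeasurableSet A) (hμ : μ A ≠ ∞) (x : X) :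
    ‖indicatorL1 μ X A x‖ = μ.real A * ‖x‖ := by
  rw [indicatorL1_eq hA hμ]; simp [norm_indicatorConstLp, mul_comm]

theorem indicatorL1_congr (hA : MeasurableSet A) (hB : MeasurableSet B) (h : A =ᵐ[μ] B) :
    indicatorL1 μ X A = indicatorL1 μ X B := by
  by_cases hμ : μ A = ∞
  · have hμ' : μ B = ∞ := measure_congr h ▸ hμ
    simp [indicatorL1, hμ, hμ']
  · ext1 x
    have hμ' : μ B ≠ ∞ := measure_congr h ▸ hμ
    rw [indicatorL1_eq hA hμ, indicatorL1_eq hB hμ']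
    exact (MemLp.toLp_eq_toLp_iff _ _).2 (indicator_ae_eq_of_ae_eq_set h)

theorem indicatorL1_union (hA : MeasurableSet A) (hB : MeasurableSet B) (hμA : μ A ≠ ∞)
    (hμB : μ B ≠ ∞) (h : Disjoint A B) :
    indicatorL1 μ X (A ∪ B) = indicatorL1 μ X A + indicatorL1 μ X B := by
  ext1 x
  have hμ : μ (A ∪ B) ≠ ∞ := by finiteness
  rw [add_apply, indicatorL1_eq hA hμA, indicatorL1_eq hB hμB,
    indicatorL1_eq (hA.union hB) hμ]
  exact indicatorConstLp_disjoint_union hA hB hμA hμB h x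

theorem indicatorL1_empty : indicatorL1 μ X ∅ = 0 := by
  ext1 x
  rw [indicatorL1_eq .empty (by simp)]
  simp

theorem indicatorL1_biUnion {ι : Type*} {F : ι → Set Ω} (hF : ∀ i, MeasurableSet (F i))
    (hd : Pairwise (Function.onFun Disjoint F)) (hμ : ∀ i, μ (F i) ≠ ∞) (s : Finset ι) :
    indicatorL1 μ X (⋃ i ∈ s, F i) = ∑ i ∈ s, indicatorL1 μ X (F i) := by
  classical
  induction s using Finset.induction_on with
  | empty => simp [indicatorL1_empty]
  | insert i s hi ih =>
    rw [Finset.set_biUnion_insert, Finset.sum_insert hi, ← ih]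
    refine indicatorL1_union (hF i) (s.measurableSet_biUnion fun j _ => hF j) (hμ i) ?_ ?_
    · exact ((measure_biUnion_finset_le s F).trans_lt
        (ENNReal.sum_lt_top.2 fun j _ => (hμ j).lt_top)).ne
    · rw [disjoint_iUnion₂_right]
      exact fun j hj => hd (ne_of_mem_of_not_mem hj hi).symm

theorem hasSum_measureReal_iUnion {F : ℕ → Set Ω} (hF : ∀ i, MeasurableSet (F i))
    (hd : Pairwise (Function.onFun Disjoint F)) (hμ : μ (⋃ i, F i) ≠ ∞) :
    HasSum (fun i => μ.real (F i)) (μ.real (⋃ i, F i)) := by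
  have h1 : μ (⋃ i, F i) = ∑' i, μ (F i) := measure_iUnion hd hF
  have h2 := ENNReal.hasSum_toReal (h1 ▸ hμ)
  rwa [← ENNReal.tsum_toReal_eq fun i => measure_ne_top_of_subset (subset_iUnion F i) hμ,
    ← h1] at h2

theorem hasSum_indicatorL1 {F : ℕ → Set Ω} (hF : ∀ i, MeasurableSet (F i))
    (hd : Pairwise (Function.onFun Disjoint F)) (hμ : μ (⋃ i, F i) ≠ ∞) (x : X) :
    HasSum (fun i => indicatorL1 μ X (F i) x) (indicatorL1 μ X (⋃ i, F i) x) := by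
  have hμi : ∀ i, μ (F i) ≠ ∞ := fun i => measure_ne_top_of_subset (subset_iUnion F i) hμ
  have hU : MeasurableSet (⋃ i, F i) := .iUnion hF
  have hm := hasSum_measureReal_iUnion hF hd hμ
  rw [HasSum, tendsto_iff_norm_sub_tendsto_zero]
  have hlim : Filter.Tendsto (fun s : Finset ℕ => (μ.real (⋃ i, F i) - ∑ i ∈ s, μ.real (F i)) * ‖x‖)
      Filter.atTop (nhds 0) := by
    have : Filter.Tendsto (fun s : Finset ℕ => ∑ i ∈ s, μ.real (F i)) Filter.atTop
      (nhds (μ.real (⋃ i, F i))) := hm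
    simpa using (this.const_sub (μ.real (⋃ i, F i))).mul_const ‖x‖
  refine hlim.congr fun s => ?_
  set V := ⋃ i ∈ s, F i with hV
  have hVU : V ⊆ ⋃ i, F i := iUnion₂_subset fun i _ => subset_iUnion F i
  have hVm : MeasurableSet V := s.measurableSet_biUnion fun j _ => hF j
  have hVμ : μ V ≠ ∞ := measure_ne_top_of_subset hVU hμ
  have hDμ : μ ((⋃ i, F i) \ V) ≠ ∞ := measure_ne_top_of_subset sdiff_subset hμ
  have h1 : indicatorL1 μ X (⋃ i, F i) = indicatorL1 μ X V + indicatorL1 μ X ((⋃ i, F i) \ V) := by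
    rw [← indicatorL1_union hVm (hU.diff hVm) hVμ hDμ disjoint_sdiff_self_right,
      union_sdiff_cancel hVU]
  have h2 : ∑ i ∈ s, indicatorL1 μ X (F i) x = indicatorL1 μ X V x := by
    rw [hV, indicatorL1_biUnion hF hd hμi s, sum_apply]
  rw [h2, h1, add_apply, sub_add_cancel_left, norm_neg,
    norm_indicatorL1 (hU.diff hVm) hDμ, measureReal_sdiff hVU hVm, hV,
    measureReal_biUnion_finset (fun i _ j _ hij => hd hij) (fun i _ => hF i)
      (fun i _ => hμi i)]

/-- The real signed measure `F ↦ φ (1_{F ∩ E} x) - s μ(F ∩ E)`. -/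
noncomputable def functionalSignedMeasure (φ : StrongDual ℝ (Lp X 1 μ)) (E : Set Ω)
    (hE : MeasurableSet E) (hμ : μ E ≠ ∞) (x : X) (s : ℝ) : SignedMeasure Ω :=
  open scoped Classical in
  { measureOf' := fun F =>
      if MeasurableSet F then φ (indicatorL1 μ X (F ∩ E) x) - s * μ.real (F ∩ E) else 0
    empty' := by simp [indicatorL1_empty]
    not_measurable' := fun F hF => if_neg hF
    m_iUnion' := fun F hF hd => by
      have hF' : ∀ i, MeasurableSet (F i ∩ E) := fun i => (hF i).inter hE
      have hd' : Pairwise (Function.onFun Disjoint fun i => F i ∩ E) := fun i j hij =>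
        (hd hij).mono inter_subset_left inter_subset_left
      have hμ' : μ (⋃ i, F i ∩ E) ≠ ∞ :=
        measure_ne_top_of_subset (iUnion_subset fun i => inter_subset_right) hμ
      have h1 := φ.hasSum (hasSum_indicatorL1 hF' hd' hμ' x)
      have h2 := hasSum_measureReal_iUnion hF' hd' hμ'
      simpa only [hF, MeasurableSet.iUnion hF, if_true, iUnion_inter] using
        h1.sub (h2.mul_left s) }

theorem functionalSignedMeasure_apply (φ : StrongDual ℝ (Lp X 1 μ)) {E : Set Ω}
    (hE : MeasurableSet E) (hμ : μ E ≠ ∞) (x : X) (s : ℝ) {F : Set Ω} (hF : MeasurableSet F)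
    (hFE : F ⊆ E) : functionalSignedMeasure φ E hE hμ x s F =
      φ (indicatorL1 μ X F x) - s * μ.real F := by
  refine (if_pos hF).trans ?_
  rw [inter_eq_left.2 hFE]

/-- A functional on `L_1(μ;X)` of norm greater than `s` exceeds `s` times the norm on some
function `1_E x`. -/
theorem exists_indicatorL1_gt {φ : StrongDual ℝ (Lp X 1 μ)} {s : ℝ} (hs : 0 ≤ s) (hφ : s < ‖φ‖) :
    ∃ E, MeasurableSet E ∧ μ E ≠ ∞ ∧ ∃ x : X, s * (μ.real E * ‖x‖) < φ (indicatorL1 μ X E x) := by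
  by_contra! hcon
  have hle : ∀ f : Lp X 1 μ, φ f ≤ s * ‖f‖ := by
    refine Lp.induction ENNReal.one_ne_top _ ?_ ?_ ?_
    · intro c E hE hμ
      rw [Lp.simpleFunc.coe_indicatorConst, ← indicatorL1_eq hE hμ.ne, norm_indicatorL1 hE hμ.ne]
      exact hcon E hE hμ.ne c
    · intro f g hf hg hd h1 h2
      rw [norm_toLp_add_of_disjoint hf hg hd, map_add, mul_add]
      exact add_le_add h1 h2
    · exact isClosed_le φ.continuous (by fun_prop)
  refine hφ.not_ge (φ.opNorm_le_bound hs fun f => abs_le.2 ⟨?_, hle f⟩)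
  have := hle (-f)
  rw [map_neg, norm_neg] at this
  linarith

/-- Localization: by a Hahn decomposition, a functional on `L_1(μ;X)` of norm greater than `s` is,
in the direction of a suitable unit vector, at least `s μ` on all subsets of some set of positive
measure. -/
theorem exists_forall_subset_le {φ : StrongDual ℝ (Lp X 1 μ)} {s : ℝ} (hs : 0 ≤ s)
    (hφ : s < ‖φ‖) :
    ∃ E, MeasurableSet E ∧ μ E ≠ 0 ∧ μ E ≠ ∞ ∧ ∃ x : X, ‖x‖ = 1 ∧
      ∀ F, MeasurableSet F → F ⊆ E → s * μ.real F ≤ φ (indicatorL1 μ X F x) := by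
  obtain ⟨E, hE, hμ, y, hy⟩ := exists_indicatorL1_gt hs hφ
  have hy0 : y ≠ 0 := by rintro rfl; simp at hy
  have hny : 0 < ‖y‖ := norm_pos_iff.2 hy0
  set x : X := ‖y‖⁻¹ • y
  have hx : ‖x‖ = 1 := by simp [x, norm_smul, hny.ne']
  have hyx : y = ‖y‖ • x := by simp [x, smul_smul, hny.ne']
  have hEx : s * μ.real E < φ (indicatorL1 μ X E x) := by
    rw [hyx, map_smul, map_smul, norm_smul, hx, smul_eq_mul, norm_norm, mul_one, ← mul_assoc,
      mul_comm ‖y‖] at hy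
    exact lt_of_mul_lt_mul_right hy hny.le
  set ν := -functionalSignedMeasure φ E hE hμ x s
  have hνE : ν E < 0 := by
    rw [neg_apply, functionalSignedMeasure_apply φ hE hμ x s hE subset_rfl]
    linarith
  obtain ⟨D, hD, hDE, hle, hνD⟩ := SignedMeasure.exists_subset_restrict_nonpos hνE
  have happ : ∀ F, MeasurableSet F → F ⊆ E → ν F = s * μ.real F - φ (indicatorL1 μ X F x) :=
    fun F hF hFE => by
      rw [neg_apply, functionalSignedMeasure_apply φ hE hμ x s hF hFE, neg_sub]
  have hDμ : μ D ≠ ∞ := measure_ne_top_of_subset hDE hμ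
  refine ⟨D, hD, fun h0 => ?_, hDμ, x, hx, fun F hF hFD => ?_⟩
  · have h1 : indicatorL1 μ X D x = 0 := by
      rw [← norm_eq_zero, norm_indicatorL1 hD hDμ, measureReal_def, h0]; simp
    rw [happ D hD hDE, h1, measureReal_def, h0] at hνD
    simp at hνD
  · have := VectorMeasure.subset_le_of_restrict_le_restrict _ _ hD hle hFD
    rw [happ F hF (hFD.trans hDE), zero_apply] at this
    linarith

end Indicators

/-! ### Atoms and atom-free sets -/

section Atoms

variable {Ω : Type*} [MeasurableSpace Ω] {μ : Measure Ω} {A B E : Set Ω}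

theorem IsMeasureAtom.subset (hA : IsMeasureAtom μ A) (hB : MeasurableSet B) (hBA : B ⊆ A)
    (h0 : μ B ≠ 0) : IsMeasureAtom μ B :=
  ⟨hB, h0, fun C hC hCB => (hA.2.2 C hC (hCB.trans hBA)).imp_right fun h =>
    measure_mono_null (sdiff_subset_sdiff_left hBA) h⟩

theorem IsMeasureAtom.ae_eq_of_subset (hA : IsMeasureAtom μ A) (hB : MeasurableSet B)
    (hBA : B ⊆ A) (h0 : μ B ≠ 0) : B =ᵐ[μ] A :=
  hBA.eventuallyLE.antisymm (ae_le_set.2 ((hA.2.2 B hB hBA).resolve_left h0))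

theorem IsMeasureAtom.ae_eq_or_aedisjoint (hA : IsMeasureAtom μ A) (hB : IsMeasureAtom μ B) :
    A =ᵐ[μ] B ∨ AEDisjoint μ A B := by
  by_cases h0 : μ (A ∩ B) = 0
  · exact .inr h0
  · have hm := hA.1.inter hB.1
    exact .inl ((hA.ae_eq_of_subset hm inter_subset_left h0).symm.trans
      (hB.ae_eq_of_subset hm inter_subset_right h0))

/-- A positive measure set without atoms contains sets of arbitrarily small positive measure. -/
theorem exists_small_subset (hE : MeasurableSet E) (h0 : μ E ≠ 0) (hμ : μ E ≠ ∞)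
    (hna : ∀ A, A ⊆ E → ¬ IsMeasureAtom μ A) {δ : ℝ≥0∞} (hδ : δ ≠ 0) :
    ∃ F, MeasurableSet F ∧ F ⊆ E ∧ μ F ≠ 0 ∧ μ F ≤ δ := by
  have step : ∀ n : ℕ, ∃ F, MeasurableSet F ∧ F ⊆ E ∧ μ F ≠ 0 ∧ μ F ≤ μ E * (2⁻¹ : ℝ≥0∞) ^ n := by
    intro n
    induction n with
    | zero => exact ⟨E, hE, subset_rfl, h0, by simp⟩
    | succ n ih =>
      obtain ⟨F, hF, hFE, hF0, hle⟩ := ih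
      have hFa := hna F hFE
      simp only [IsMeasureAtom, not_and, not_forall, not_or] at hFa
      obtain ⟨B, hB, hBF, hB0, hFB0⟩ := hFa hF hF0
      -- one of the two halves has at most half of the measure
      have hsum : μ B + μ (F \ B) = μ F := by
        rw [measure_add_sdiff hB.nullMeasurableSet, union_eq_right.2 hBF]
      have hhalf : μ F * 2⁻¹ ≤ μ E * (2⁻¹ : ℝ≥0∞) ^ (n + 1) := by
        rw [pow_succ, ← mul_assoc]; gcongr
      rcases le_total (μ B) (μ (F \ B)) with h | h
      · refine ⟨B, hB, hBF.trans hFE, hB0, le_trans ?_ hhalf⟩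
        rw [← div_eq_mul_inv, ENNReal.le_div_iff_mul_le (by simp) (by simp), mul_two, ← hsum]
        gcongr
      · refine ⟨F \ B, hF.diff hB, sdiff_subset.trans hFE, hFB0, le_trans ?_ hhalf⟩
        rw [← div_eq_mul_inv, ENNReal.le_div_iff_mul_le (by simp) (by simp), mul_two, ← hsum]
        gcongr
  have hlim : Filter.Tendsto (fun n : ℕ => μ E * (2⁻¹ : ℝ≥0∞) ^ n) Filter.atTop (nhds 0) := by
    have := ENNReal.Tendsto.const_mul (a := μ E)
      (ENNReal.tendsto_pow_atTop_nhds_zero_of_lt_one (r := 2⁻¹) (by simp)) (.inr hμ)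
    simpa using this
  obtain ⟨n, hn⟩ := (hlim.eventually (ge_mem_nhds (pos_iff_ne_zero.2 hδ))).exists
  obtain ⟨F, hF, hFE, hF0, hle⟩ := step n
  exact ⟨F, hF, hFE, hF0, hle.trans hn⟩

/-- Countably many sets of finite positive measure without atoms contain pairwise disjoint sets of
positive measure. -/
theorem exists_disjoint_subsets_nat {E : ℕ → Set Ω} (hE : ∀ n, MeasurableSet (E n))
    (h0 : ∀ n, μ (E n) ≠ 0) (hμ : ∀ n, μ (E n) ≠ ∞)
    (hna : ∀ n, ∀ A, A ⊆ E n → ¬ IsMeasureAtom μ A) :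
    ∃ F : ℕ → Set Ω, (∀ n, MeasurableSet (F n) ∧ F n ⊆ E n ∧ μ (F n) ≠ 0) ∧
      Pairwise (Function.onFun Disjoint F) := by
  -- choose `G n ⊆ E n` with quickly decreasing measures, then remove the later sets from each
  have key : ∀ n, ∀ δ : ℝ≥0∞, ∃ G, MeasurableSet G ∧ G ⊆ E n ∧ μ G ≠ 0 ∧ (δ ≠ 0 → μ G ≤ δ) := by
    intro n δ
    by_cases hδ : δ = 0
    · exact ⟨E n, hE n, subset_rfl, h0 n, fun h => absurd hδ h⟩
    · obtain ⟨G, h1, h2, h3, h4⟩ := exists_small_subset (hE n) (h0 n) (hμ n) (hna n) hδ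
      exact ⟨G, h1, h2, h3, fun _ => h4⟩
  choose S hSm hSE hS0 hSle using key
  let G : ℕ → Set Ω := fun n => Nat.rec (S 0 1) (fun n T => S (n + 1) (μ T * 4⁻¹)) n
  have hGs : ∀ n, G (n + 1) = S (n + 1) (μ (G n) * 4⁻¹) := fun n => rfl
  have hG : ∀ n, MeasurableSet (G n) ∧ G n ⊆ E n ∧ μ (G n) ≠ 0 := by
    intro n
    cases n with
    | zero => exact ⟨hSm 0 1, hSE 0 1, hS0 0 1⟩
    | succ n => exact ⟨hSm _ _, hSE _ _, hS0 _ _⟩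
  have hGle : ∀ n, μ (G (n + 1)) ≤ μ (G n) * 4⁻¹ := fun n => by
    rw [hGs]; exact hSle _ _ (mul_ne_zero (hG n).2.2 (by simp))
  have hGpow : ∀ n k, μ (G (n + 1 + k)) ≤ μ (G n) * 4⁻¹ * (2⁻¹ : ℝ≥0∞) ^ k := by
    intro n k
    induction k with
    | zero => simpa using hGle n
    | succ k ih =>
      calc μ (G (n + 1 + k + 1)) ≤ μ (G (n + 1 + k)) * 4⁻¹ := hGle _
        _ ≤ μ (G n) * 4⁻¹ * (2⁻¹ : ℝ≥0∞) ^ k * 2⁻¹ := by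
          gcongr
          norm_num
        _ = _ := by rw [pow_succ, mul_assoc _ _ (2⁻¹ : ℝ≥0∞)]
  refine ⟨fun n => G n \ ⋃ k, G (n + 1 + k), fun n => ⟨(hG n).1.diff (.iUnion fun k => (hG _).1),
    sdiff_subset.trans (hG n).2.1, fun hz => ?_⟩, ?_⟩
  · have hGfin : μ (G n) ≠ ∞ := measure_ne_top_of_subset (hG n).2.1 (hμ n)
    have htail : μ (⋃ k, G (n + 1 + k)) ≤ μ (G n) * 2⁻¹ := by
      calc μ (⋃ k, G (n + 1 + k)) ≤ ∑' k, μ (G (n + 1 + k)) := measure_iUnion_le _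
        _ ≤ ∑' k, μ (G n) * 4⁻¹ * (2⁻¹ : ℝ≥0∞) ^ k := ENNReal.tsum_le_tsum (hGpow n)
        _ = μ (G n) * 4⁻¹ * 2 := by rw [ENNReal.tsum_mul_left, ENNReal.tsum_geometric_two]
        _ = μ (G n) * 2⁻¹ := by
          rw [mul_assoc]
          congr 1
          rw [← ENNReal.toReal_eq_toReal_iff' (by finiteness) (by finiteness)]
          norm_num
    have hle : μ (G n) ≤ μ (G n) * 2⁻¹ := by
      calc μ (G n) ≤ μ (G n \ ⋃ k, G (n + 1 + k)) + μ (⋃ k, G (n + 1 + k)) := by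
            exact (measure_mono (by rw [sdiff_union_self]; exact subset_union_left)).trans
              (measure_union_le _ _)
        _ ≤ μ (G n) * 2⁻¹ := by rw [hz, zero_add]; exact htail
    rw [← div_eq_mul_inv] at hle
    exact (ENNReal.half_lt_self (hG n).2.2 hGfin).not_ge hle
  · have hlt : ∀ i j, i < j →
        Disjoint (G i \ ⋃ k, G (i + 1 + k)) (G j \ ⋃ k, G (j + 1 + k)) := by
      intro i j hij
      obtain ⟨k, rfl⟩ := Nat.exists_eq_add_of_lt hij
      refine disjoint_sdiff_left.mono_right (sdiff_subset.trans ?_)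
      rw [add_right_comm]
      exact subset_iUnion (fun k => G (i + 1 + k)) k
    intro i j hij
    rcases hij.lt_or_gt with h | h
    · exact hlt i j h
    · exact (hlt j i h).symm

/-- The members of a countable family of sets, each an atom or without atoms, can be shrunk to sets
of positive measure such that two of them with different indices are almost disjoint or are
almost equal atoms. -/
theorem exists_refinement {J : Type*} [Countable J] {E : J → Set Ω}
    (hE : ∀ j, MeasurableSet (E j)) (h0 : ∀ j, μ (E j) ≠ 0) (hμ : ∀ j, μ (E j) ≠ ∞)
    (hat : ∀ j, IsMeasureAtom μ (E j) ∨ ∀ A, A ⊆ E j → ¬ IsMeasureAtom μ A) :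
    ∃ F : J → Set Ω, (∀ j, MeasurableSet (F j) ∧ F j ⊆ E j ∧ μ (F j) ≠ 0) ∧
      ∀ i j, i = j ∨ AEDisjoint μ (F i) (F j) ∨ (IsMeasureAtom μ (F i) ∧ F i =ᵐ[μ] F j) := by
  classical
  by_cases hall : ∀ j, IsMeasureAtom μ (E j)
  · refine ⟨E, fun j => ⟨hE j, subset_rfl, h0 j⟩, fun i j => .inr ?_⟩
    rcases (hall i).ae_eq_or_aedisjoint (hall j) with h | h
    exacts [.inr ⟨hall i, h⟩, .inl h]
  · push Not at hall
    obtain ⟨k, hk⟩ := hall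
    have : Nonempty {j // ¬ IsMeasureAtom μ (E j)} := ⟨⟨k, hk⟩⟩
    obtain ⟨e, he⟩ := exists_surjective_nat {j // ¬ IsMeasureAtom μ (E j)}
    obtain ⟨G, hG, hGd⟩ := exists_disjoint_subsets_nat (E := fun n => E (e n)) (fun n => hE _)
      (fun n => h0 _) (fun n => hμ _) (fun n => (hat _).resolve_left (e n).2)
    choose g hg using he
    have hginj : Function.Injective g := fun a b hab => by rw [← hg a, hab, hg b]
    have hGE : ∀ a, G (g a) ⊆ E a := fun a => by
      have h := (hG (g a)).2.1
      rwa [hg a] at h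
    let F : J → Set Ω := fun j => if h : IsMeasureAtom μ (E j) then E j else G (g ⟨j, h⟩)
    have hF1 : ∀ {j}, IsMeasureAtom μ (E j) → F j = E j := fun h => dif_pos h
    have hF2 : ∀ {j} (h : ¬ IsMeasureAtom μ (E j)), F j = G (g ⟨j, h⟩) := fun h => dif_neg h
    have hmix : ∀ {i j}, IsMeasureAtom μ (E i) → ¬ IsMeasureAtom μ (E j) →
        AEDisjoint μ (F i) (F j) := by
      intro i j hi hj
      rw [hF1 hi, hF2 hj]
      by_contra hne
      exact (hat j).resolve_left hj _ (inter_subset_right.trans (hGE ⟨j, hj⟩))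
        (hi.subset (hi.1.inter (hG _).1) inter_subset_left hne)
    refine ⟨F, fun j => ?_, fun i j => ?_⟩
    · by_cases hj : IsMeasureAtom μ (E j)
      · rw [hF1 hj]; exact ⟨hE j, subset_rfl, h0 j⟩
      · rw [hF2 hj]; exact ⟨(hG _).1, hGE ⟨j, hj⟩, (hG _).2.2⟩
    · by_cases hi : IsMeasureAtom μ (E i) <;> by_cases hj : IsMeasureAtom μ (E j)
      · rw [hF1 hi, hF1 hj]
        rcases hi.ae_eq_or_aedisjoint hj with h | h
        exacts [.inr (.inr ⟨hi, h⟩), .inr (.inl h)]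
      · exact .inr (.inl (hmix hi hj))
      · exact .inr (.inl (hmix hj hi).symm)
      · by_cases hij : i = j
        · exact .inl hij
        · rw [hF2 hi, hF2 hj]
          refine .inr (.inl (hGd fun h => hij ?_).aedisjoint)
          simpa using hginj h

end Atoms

/-! ### From `X` to `L_1(μ;X)` -/

section Lift

variable {Ω : Type*} [MeasurableSpace Ω] {μ : Measure Ω}
  {X : Type*} [NormedAddCommGroup X] [NormedSpace ℝ X]

/-- Gluing: functionals on `X` placed on countably many almost disjoint sets define a functional on
`L_1(μ;X)`. -/
theorem exists_functional_glue [CompleteSpace X] {Q : Type*} [Countable Q] {D : Q → Set Ω}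
    (hD : ∀ q, MeasurableSet (D q)) (hd : Pairwise (Function.onFun (AEDisjoint μ) D))
    (hμ : ∀ q, μ (D q) ≠ ∞) (y : Q → StrongDual ℝ X) (hy : ∀ q, ‖y q‖ ≤ 1) :
    ∃ f : StrongDual ℝ (Lp X 1 μ), ‖f‖ ≤ 1 ∧
      ∀ q x, f (indicatorL1 μ X (D q) x) = μ.real (D q) * y q x := by
  have hint : ∀ g : Lp X 1 μ, Integrable g μ := L1.integrable_coeFn
  have hsum : ∀ g : Lp X 1 μ, HasSum (fun q => ∫ ω in D q, ‖g ω‖ ∂μ) (∫ ω in ⋃ q, D q, ‖g ω‖ ∂μ) :=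
    fun g => hasSum_integral_iUnion_ae (fun q => (hD q).nullMeasurableSet) hd
      (hint g).norm.integrableOn
  have hle : ∀ (g : Lp X 1 μ) q, ‖y q (∫ ω in D q, g ω ∂μ)‖ ≤ ∫ ω in D q, ‖g ω‖ ∂μ := fun g q =>
    ((y q).le_opNorm _).trans ((mul_le_of_le_one_left (norm_nonneg _) (hy q)).trans
      (norm_integral_le_integral_norm _))
  have hs : ∀ g : Lp X 1 μ, Summable fun q => y q (∫ ω in D q, g ω ∂μ) := fun g =>
    .of_norm_bounded (hsum g).summable (hle g)
  let f : StrongDual ℝ (Lp X 1 μ) := LinearMap.mkContinuous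
    { toFun := fun g => ∑' q, y q (∫ ω in D q, g ω ∂μ)
      map_add' := fun g g' => by
        rw [← (hs g).tsum_add (hs g')]
        congr 1
        ext q
        rw [← map_add, ← integral_add (hint g).integrableOn (hint g').integrableOn]
        congr 1
        exact integral_congr_ae (ae_restrict_of_ae (Lp.coeFn_add g g'))
      map_smul' := fun a g => by
        rw [RingHom.id_apply, smul_eq_mul, ← tsum_mul_left]
        congr 1
        ext q
        rw [← smul_eq_mul, ← map_smul, ← integral_smul]
        congr 1
        exact integral_congr_ae (ae_restrict_of_ae (Lp.coeFn_smul a g)) } 1 fun g => by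
      calc ‖∑' q, y q (∫ ω in D q, g ω ∂μ)‖ ≤ ∫ ω in ⋃ q, D q, ‖g ω‖ ∂μ :=
            tsum_of_norm_bounded (hsum g) (hle g)
        _ ≤ ∫ ω, ‖g ω‖ ∂μ :=
            setIntegral_le_integral (hint g).norm (.of_forall fun ω => norm_nonneg _)
        _ = 1 * ‖g‖ := by rw [one_mul, L1.norm_eq_integral_norm]
  refine ⟨f, LinearMap.mkContinuous_norm_le _ zero_le_one _, fun q x => ?_⟩
  have hterm : ∀ q', ∫ ω in D q', indicatorL1 μ X (D q) x ω ∂μ = μ.real (D q ∩ D q') • x :=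
    fun q' => by
      rw [indicatorL1_eq (hD q) (hμ q), setIntegral_indicatorConstLp (hD q')]
  change ∑' q', y q' (∫ ω in D q', indicatorL1 μ X (D q) x ω ∂μ) = _
  rw [tsum_eq_single q]
  · rw [hterm, inter_self, map_smul, smul_eq_mul]
  · intro q' hq'
    have h0 : μ.real (D q ∩ D q') = 0 := by
      rw [measureReal_def, show μ (D q ∩ D q') = 0 from hd hq'.symm, ENNReal.toReal_zero]
    rw [hterm, h0, zero_smul, map_zero]

theorem exists_forall_subset_le_atom_or {φ : StrongDual ℝ (Lp X 1 μ)} {s : ℝ} (hs : 0 ≤ s)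
    (hφ : s < ‖φ‖) :
    ∃ E, MeasurableSet E ∧ μ E ≠ 0 ∧ μ E ≠ ∞ ∧
      (IsMeasureAtom μ E ∨ ∀ A, A ⊆ E → ¬ IsMeasureAtom μ A) ∧ ∃ x : X, ‖x‖ = 1 ∧
        ∀ F, MeasurableSet F → F ⊆ E → s * μ.real F ≤ φ (indicatorL1 μ X F x) := by
  obtain ⟨E, hE, h0, hμ, x, hx, h⟩ := exists_forall_subset_le hs hφ
  by_cases hat : ∃ A, A ⊆ E ∧ IsMeasureAtom μ A
  · obtain ⟨A, hAE, hA⟩ := hat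
    exact ⟨A, hA.1, hA.2.1, measure_ne_top_of_subset hAE hμ, .inl hA, x, hx,
      fun F hF hFA => h F hF (hFA.trans hAE)⟩
  · exact ⟨E, hE, h0, hμ, .inr fun A hAE hA => hat ⟨A, hAE, hA⟩, x, hx, h⟩

/-- Applying the property of `X` to the restrictions of functionals on `L_1(μ;X)` to a set `D`:
restrictions that are large compared with `μ D` are normed. -/
theorem exists_functional_of_restrictions [Nontrivial X] {ι : Type} {R' : Set ℝ} {t : ℝ}
    (hX : HasAlignedNorming X ι R' t) (φ : ι → StrongDual ℝ (Lp X 1 μ)) (D : Set Ω) :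
    ∃ y : StrongDual ℝ X, ‖y‖ ≤ 1 ∧ ∀ i, ∀ r' ∈ R', 0 ≤ r' → ∀ x : X, ‖x‖ = 1 →
      ∀ a, 0 < a → a ≤ φ i (indicatorL1 μ X D x) →
        ∃ b : X, ‖b‖ = 1 ∧ t ≤ y b ∧ r' * a ≤ φ i (indicatorL1 μ X D b) := by
  classical
  obtain ⟨u, hu⟩ := exists_unit_functional (E := X)
  let ψ : ι → StrongDual ℝ X := fun i => (φ i).comp (indicatorL1 μ X D)
  obtain ⟨y, hy, h⟩ := hX (fun i => if ψ i = 0 then u else ‖ψ i‖⁻¹ • ψ i) fun i => by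
    by_cases hi : ψ i = 0
    · simp [hi, hu]
    · simp [hi, norm_smul]
  refine ⟨y, hy, fun i r' hr' h0 x hx a ha hax => ?_⟩
  have hψ : a ≤ ‖ψ i‖ := by
    have h1 : ψ i x ≤ ‖ψ i‖ * ‖x‖ := (le_abs_self _).trans ((ψ i).le_opNorm x)
    rw [hx, mul_one] at h1
    exact hax.trans h1
  have hpos : 0 < ‖ψ i‖ := ha.trans_le hψ
  obtain ⟨b, hb, h1, h2⟩ := h i r' hr'
  refine ⟨b, hb, h2, ?_⟩
  simp only [if_neg (norm_pos_iff.1 hpos)] at h1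
  have h3 : r' ≤ ‖ψ i‖⁻¹ * ψ i b := h1
  rw [inv_mul_eq_div, le_div_iff₀ hpos] at h3
  exact (mul_le_mul_of_nonneg_left hψ h0).trans h3

/-- If `X` has the norming property whenever `μ` has atoms, then so does `L_1(μ;X)`, up to the loss
of a factor `s < 1` in the norming constants. -/
theorem hasAlignedNorming_L1 [CompleteSpace X] [Nontrivial X] {ι : Type} [Countable ι]
    {R R' : Set ℝ} {t : ℝ} (hRc : R.Countable) (ht : t ≤ 1)
    (hR : ∀ r ∈ R, ∃ r' ∈ R', ∃ s ∈ Ioo (0 : ℝ) 1, 0 ≤ r' ∧ r ≤ s ∧ r ≤ r' * s)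
    (hX : HasAtoms μ → HasAlignedNorming X ι R' t) :
    HasAlignedNorming (Lp X 1 μ) ι R t := by
  intro φ hφ
  have : Countable R := hRc.to_subtype
  choose r' hr' s hs hr0 hrs hrrs using fun j : ι × R => hR j.2 j.2.2
  choose E hE hE0 hEμ hEat x hx hφE using fun j : ι × R =>
    exists_forall_subset_le_atom_or (φ := φ j.1) (hs j).1.le ((hs j).2.trans_eq (hφ j.1).symm)
  obtain ⟨F, hF, hFF⟩ := exists_refinement hE hE0 hEμ hEat
  -- almost equal pieces are identified; `D` picks one piece from each class
  let S : Setoid (ι × R) := ⟨fun i j => F i =ᵐ[μ] F j,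
    fun i => Filter.EventuallyEq.rfl, fun h => h.symm, fun h h' => h.trans h'⟩
  let D : Quotient S → Set Ω := fun q => F q.out
  have hDm : ∀ q, MeasurableSet (D q) := fun q => (hF _).1
  have hD0 : ∀ q, μ (D q) ≠ 0 := fun q => (hF _).2.2
  have hDμ : ∀ q, μ (D q) ≠ ∞ := fun q => measure_ne_top_of_subset (hF _).2.1 (hEμ _)
  have hDpos : ∀ q, 0 < μ.real (D q) := fun q => ENNReal.toReal_pos (hD0 q) (hDμ q)
  have hDF : ∀ j, F j =ᵐ[μ] D (Quotient.mk S j) := fun j => (Quotient.mk_out (s := S) j).symm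
  have hDd : Pairwise (Function.onFun (AEDisjoint μ) D) := by
    intro p q hpq
    rcases hFF p.out q.out with h | h | h
    · exact absurd (by rw [← p.out_eq, ← q.out_eq, h]) hpq
    · exact h
    · exact absurd (by rw [← p.out_eq, ← q.out_eq]; exact Quotient.sound h.2) hpq
  have hDφ : ∀ j, s j * μ.real (D (Quotient.mk S j)) ≤
      φ j.1 (indicatorL1 μ X (D (Quotient.mk S j)) (x j)) := fun j => by
    rw [← indicatorL1_congr (hF j).1 (hDm _) (hDF j), ← measureReal_congr (hDF j)]
    exact hφE j _ (hF j).1 (hF j).2.1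
  have hlocal : ∀ q, ∃ y : StrongDual ℝ X, ‖y‖ ≤ 1 ∧ ∀ j, Quotient.mk S j = q → ∃ b : X,
      ‖b‖ = 1 ∧ t ≤ y b ∧ j.2 * μ.real (D q) ≤ φ j.1 (indicatorL1 μ X (D q) b) := by
    intro q
    by_cases hA : IsMeasureAtom μ (D q)
    · obtain ⟨y, hy, h⟩ := exists_functional_of_restrictions (hX ⟨_, hA⟩) φ (D q)
      refine ⟨y, hy, ?_⟩
      rintro j rfl
      obtain ⟨b, hb, h1, h2⟩ := h j.1 (r' j) (hr' j) (hr0 j) (x j) (hx j) _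
        (mul_pos (hs j).1 (hDpos _)) (hDφ j)
      refine ⟨b, hb, h1, le_trans ?_ h2⟩
      rw [← mul_assoc]
      exact mul_le_mul_of_nonneg_right (hrrs j) (hDpos _).le
    · -- a class whose piece is not an atom has only one member
      obtain ⟨y, hy, hyx⟩ := exists_dual_vector'' ℝ (x q.out)
      refine ⟨y, hy, ?_⟩
      rintro j hj
      have hjq : j = q.out := by
        rcases hFF q.out j with h | h | h
        · exact h.symm
        · have h1 : μ (F q.out ∩ F j) = 0 := h
          have h2 : F j =ᵐ[μ] F q.out := by simpa only [hj] using hDF j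
          rw [measure_congr ((Filter.EventuallyEq.rfl).inter h2), inter_self] at h1
          exact absurd h1 (hD0 q)
        · exact absurd h.1 hA
      have h1 := hDφ j
      rw [hj] at h1
      refine ⟨x j, hx j, ?_, le_trans ?_ h1⟩
      · rw [hjq, hyx, hx]; simpa using ht
      · exact mul_le_mul_of_nonneg_right (hrs j) (hDpos _).le
  choose y hy hlocal using hlocal
  obtain ⟨f, hf, hfD⟩ := exists_functional_glue hDm hDd hDμ y hy
  refine ⟨f, hf, fun i r hr => ?_⟩
  obtain ⟨b, hb, h1, h2⟩ := hlocal _ (i, ⟨r, hr⟩) rfl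
  set q := Quotient.mk S (i, ⟨r, hr⟩)
  have hp := hDpos q
  refine ⟨(μ.real (D q))⁻¹ • indicatorL1 μ X (D q) b, ?_, ?_, ?_⟩
  · rw [norm_smul, norm_indicatorL1 (hDm q) (hDμ q), hb, mul_one, norm_inv,
      Real.norm_of_nonneg hp.le, inv_mul_cancel₀ hp.ne']
  · rw [map_smul, smul_eq_mul, inv_mul_eq_div, le_div_iff₀ hp]
    exact h2
  · rw [map_smul, smul_eq_mul, hfD, inv_mul_cancel_left₀ hp.ne']
    exact h1

end Lift

/-! ### From `L_1(μ;X)` to `X` in the presence of an atom -/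

section Descent

variable {Ω : Type*} [MeasurableSpace Ω] {μ : Measure Ω}

/-- A strongly measurable function is almost everywhere constant on an atom. -/
theorem IsMeasureAtom.exists_ae_eq_const {X : Type*} [MetricSpace X] [Nonempty X]
    {A : Set Ω} (hA : IsMeasureAtom μ A) {f : Ω → X} (hf : AEStronglyMeasurable f μ) :
    ∃ c, ∀ᵐ ω ∂μ.restrict A, f ω = c := by
  borelize X
  obtain ⟨g, hg, hfg⟩ := hf
  have : TopologicalSpace.SeparableSpace (range g) := hg.isSeparable_range.separableSpace
  have : SecondCountableTopology (range g) := UniformSpace.secondCountable_of_separable _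
  obtain ⟨c, hc⟩ := Filter.exists_eventuallyEq_const_of_eventually_mem_of_forall_separating
    (l := ae (μ.restrict A)) (f := g) (s := range g) IsOpen (.of_forall fun ω => mem_range_self ω)
    fun U hU => by
      have hm : MeasurableSet (g ⁻¹' U) := hg.measurable hU.measurableSet
      rcases hA.2.2 (A ∩ g ⁻¹' U) (hA.1.inter hm) inter_subset_left with h | h
      · right
        rw [ae_restrict_iff' hA.1, ae_iff]
        simpa [Set.inter_def] using h
      · left
        rw [ae_restrict_iff' hA.1, ae_iff]
        refine measure_mono_null (fun ω hω => ?_) h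
        simpa using hω
  refine ⟨c, ?_⟩
  filter_upwards [ae_restrict_of_ae hfg, hc] with ω h1 h2
  rw [h1, h2, Function.const_apply]

variable {X : Type*} [NormedAddCommGroup X] [NormedSpace ℝ X]

variable (μ X) in
/-- The map `f ↦ ∫_A f dμ` on `L_1(μ;X)`. -/
noncomputable def setIntegralL1 (A : Set Ω) : Lp X 1 μ →L[ℝ] X :=
  LinearMap.mkContinuous
    { toFun := fun f => ∫ ω in A, f ω ∂μ
      map_add' := fun f g => by
        rw [← integral_add (L1.integrable_coeFn f).integrableOn (L1.integrable_coeFn g).integrableOn]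
        exact integral_congr_ae (ae_restrict_of_ae (Lp.coeFn_add f g))
      map_smul' := fun a f => by
        rw [RingHom.id_apply, ← integral_smul]
        exact integral_congr_ae (ae_restrict_of_ae (Lp.coeFn_smul a f)) } 1 fun f => by
    calc ‖∫ ω in A, f ω ∂μ‖ ≤ ∫ ω in A, ‖f ω‖ ∂μ := norm_integral_le_integral_norm _
      _ ≤ ∫ ω, ‖f ω‖ ∂μ := setIntegral_le_integral (L1.integrable_coeFn f).norm
          (.of_forall fun ω => norm_nonneg _)
      _ = 1 * ‖f‖ := by rw [one_mul, L1.norm_eq_integral_norm]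

theorem norm_setIntegralL1_le (A : Set Ω) : ‖setIntegralL1 μ X A‖ ≤ 1 :=
  LinearMap.mkContinuous_norm_le _ zero_le_one _

variable [CompleteSpace X] {A : Set Ω}

theorem setIntegralL1_indicatorL1 (hA : MeasurableSet A) (hμ : μ A ≠ ∞) (x : X) :
    setIntegralL1 μ X A (indicatorL1 μ X A x) = μ.real A • x := by
  change ∫ ω in A, indicatorL1 μ X A x ω ∂μ = _
  rw [indicatorL1_eq hA hμ, setIntegral_indicatorConstLp hA, inter_self]

/-- On an atom, averaging is an `L`-projection: the norm of `f` is the sum of the norms of its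
average part and of the remainder. -/
theorem IsMeasureAtom.norm_sub_average (hA : IsMeasureAtom μ A) (hμ : μ A ≠ ∞) (f : Lp X 1 μ) :
    ‖f - (μ.real A)⁻¹ • indicatorL1 μ X A (setIntegralL1 μ X A f)‖ =
      ‖f‖ - ‖setIntegralL1 μ X A f‖ := by
  have hpos : 0 < μ.real A := ENNReal.toReal_pos hA.2.1 hμ
  obtain ⟨c, hc⟩ := hA.exists_ae_eq_const (Lp.aestronglyMeasurable f)
  have hfi := L1.integrable_coeFn f
  have hP : setIntegralL1 μ X A f = μ.real A • c := by
    change ∫ ω in A, f ω ∂μ = _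
    rw [integral_congr_ae hc]
    simp
  have hJ : (μ.real A)⁻¹ • indicatorL1 μ X A (setIntegralL1 μ X A f) = indicatorL1 μ X A c := by
    rw [hP, map_smul, inv_smul_smul₀ hpos.ne']
  have hsub : ∀ᵐ ω ∂μ, (f - indicatorL1 μ X A c : Lp X 1 μ) ω = Aᶜ.indicator f ω := by
    filter_upwards [Lp.coeFn_sub f (indicatorL1 μ X A c), indicatorL1_coeFn hA.1 hμ c,
      (ae_restrict_iff' hA.1).1 hc] with ω h1 h2 h3
    rw [h1, Pi.sub_apply, h2]
    by_cases hω : ω ∈ A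
    · simp [hω, h3 hω]
    · simp [hω]
  have h1 : ∫ ω in A, ‖f ω‖ ∂μ = μ.real A * ‖c‖ := by
    rw [integral_congr_ae (hc.mono fun ω hω => congrArg norm hω)]
    simp
  have h2 : ∫ ω in A, ‖f ω‖ ∂μ + ∫ ω in Aᶜ, ‖f ω‖ ∂μ = ∫ ω, ‖f ω‖ ∂μ :=
    integral_add_compl hA.1 hfi.norm
  rw [hJ, hP, norm_smul, Real.norm_of_nonneg hpos.le, L1.norm_eq_integral_norm,
    L1.norm_eq_integral_norm, integral_congr_ae (hsub.mono fun ω hω => congrArg norm hω)]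
  simp only [norm_indicator_eq_indicator_norm]
  rw [integral_indicator hA.1.compl]
  linarith

/-- An atom makes `X` an `L`-summand of `L_1(μ;X)`, and the norming property passes to it. -/
theorem hasAlignedNorming_of_L1 (hA : IsMeasureAtom μ A) (hμ : μ A ≠ ∞) {ι : Type}
    {R R' : Set ℝ} {t t' : ℝ} (ht : t ≤ 1)
    (hR : ∀ r ∈ R, ∃ r' ∈ R', 0 < r' ∧ 0 ≤ r ∧ r ≤ r' ∧ 1 - t' ≤ (1 - t) * r')
    (h : HasAlignedNorming (Lp X 1 μ) ι R' t') : HasAlignedNorming X ι R t := by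
  intro ψ hψ
  have hpos : 0 < μ.real A := ENNReal.toReal_pos hA.2.1 hμ
  let J : X →L[ℝ] Lp X 1 μ := (μ.real A)⁻¹ • indicatorL1 μ X A
  let P := setIntegralL1 μ X A
  have hJ : ∀ x, ‖J x‖ = ‖x‖ := fun x => by
    change ‖(μ.real A)⁻¹ • indicatorL1 μ X A x‖ = ‖x‖
    rw [norm_smul, norm_indicatorL1 hA.1 hμ, norm_inv, Real.norm_of_nonneg hpos.le,
      inv_mul_cancel_left₀ hpos.ne']
  have hPJ : ∀ x, P (J x) = x := fun x => by
    change P ((μ.real A)⁻¹ • indicatorL1 μ X A x) = x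
    rw [map_smul, setIntegralL1_indicatorL1 hA.1 hμ, inv_smul_smul₀ hpos.ne']
  have hΦ : ∀ i, ‖(ψ i).comp P‖ = 1 := fun i => by
    refine le_antisymm ?_ ?_
    · calc ‖(ψ i).comp P‖ ≤ ‖ψ i‖ * ‖P‖ := ContinuousLinearMap.opNorm_comp_le _ _
        _ ≤ 1 := by rw [hψ i, one_mul]; exact norm_setIntegralL1_le A
    · rw [← hψ i]
      refine (ψ i).opNorm_le_bound (norm_nonneg _) fun x => ?_
      have := ((ψ i).comp P).le_opNorm (J x)
      rwa [hJ, ContinuousLinearMap.comp_apply, hPJ] at this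
  obtain ⟨g, hg, h⟩ := h (fun i => (ψ i).comp P) hΦ
  have hy : ‖g.comp J‖ ≤ 1 := by
    refine ContinuousLinearMap.opNorm_le_bound _ zero_le_one fun x => ?_
    have := g.le_opNorm (J x)
    rw [hJ] at this
    exact this.trans (mul_le_mul_of_nonneg_right hg (norm_nonneg x))
  refine ⟨g.comp J, hy, fun i r hr => ?_⟩
  obtain ⟨r', hr', h0, hr0, hrr, htt⟩ := hR r hr
  obtain ⟨f, hf, h1, h2⟩ := h i r' hr'
  set x := P f with hxdef
  have h1 : r' ≤ ψ i x := h1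
  have hux : r' ≤ ‖x‖ := by
    have h3 := (le_abs_self _).trans ((ψ i).le_opNorm x)
    rw [hψ i, one_mul] at h3
    exact h1.trans h3
  have hx : ‖x‖ ≤ 1 := by
    have h3 := P.le_opNorm f
    rw [hf, mul_one] at h3
    exact h3.trans (norm_setIntegralL1_le A)
  have hxpos : 0 < ‖x‖ := h0.trans_le hux
  -- the part of `f` off the atom contributes at most `1 - ‖x‖` to `g f`
  have hgx : t' - (1 - ‖x‖) ≤ g (J x) := by
    have h3 : ‖f - J x‖ = ‖f‖ - ‖x‖ := hA.norm_sub_average hμ f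
    have h4 : g (f - J x) ≤ ‖f - J x‖ := (le_abs_self _).trans
      ((g.le_opNorm _).trans (mul_le_of_le_one_left (norm_nonneg _) hg))
    rw [map_sub] at h4
    linarith
  refine ⟨‖x‖⁻¹ • x, by simp [norm_smul, hxpos.ne'], ?_, ?_⟩
  · rw [map_smul, smul_eq_mul, inv_mul_eq_div, le_div_iff₀ hxpos]
    exact ((mul_le_of_le_one_right hr0 hx).trans hrr).trans h1
  · rw [map_smul, smul_eq_mul, inv_mul_eq_div, le_div_iff₀ hxpos]
    refine le_trans ?_ hgx
    have := mul_le_mul_of_nonneg_left hux (sub_nonneg.2 ht)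
    linarith

end Descent

/-! ### Sets of finite positive measure -/

section Semifinite

variable {Ω : Type*} [MeasurableSpace Ω] {μ : Measure Ω}

theorem IsDecomposable.exists_subset (h : IsDecomposable μ) {E : Set Ω} (hE : MeasurableSet E)
    (h0 : μ E ≠ 0) : ∃ F ⊆ E, MeasurableSet F ∧ μ F ≠ 0 ∧ μ F ≠ ∞ := by
  obtain ⟨𝓕, -, -, hm, -, hsum⟩ := h
  rw [hsum E hE, Ne, ENNReal.tsum_eq_zero, not_forall] at h0
  obtain ⟨D, hD⟩ := h0
  exact ⟨E ∩ D, inter_subset_left, hE.inter (hm D D.2).1, hD,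
    measure_ne_top_of_subset inter_subset_right (hm D D.2).2.ne⟩

variable {X : Type*} [NormedAddCommGroup X] [NormedSpace ℝ X]

/-- On a set all of whose subsets have measure zero or infinity, a constant nonzero functional
would be a nonzero element of `L_∞(μ;X*)` that annihilates `L_1(μ;X)`. -/
theorem DualOfL1IsLinfty.exists_subset [Nontrivial X] (h : DualOfL1IsLinfty X μ) {E : Set Ω}
    (hE : MeasurableSet E) (h0 : μ E ≠ 0) : ∃ F ⊆ E, MeasurableSet F ∧ μ F ≠ 0 ∧ μ F ≠ ∞ := by
  obtain ⟨Φ, hΦ⟩ := h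
  by_contra! hcon
  obtain ⟨u, hu⟩ := exists_unit_functional (E := X)
  have hmem : MemLp (E.indicator fun _ => u) ∞ μ := (memLp_top_const u).indicator hE
  have hzero : Φ (hmem.toLp _) = 0 := by
    suffices ∀ f : Lp X 1 μ, Φ (hmem.toLp _) f = 0 by ext1 f; exact this f
    refine Lp.induction ENNReal.one_ne_top _ ?_ ?_ ?_
    · intro c F hF hμ
      have hnull : μ (E ∩ F) = 0 := by
        by_contra hne
        exact measure_ne_top_of_subset inter_subset_right hμ.ne
          (hcon (E ∩ F) inter_subset_left (hE.inter hF) hne)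
      rw [Lp.simpleFunc.coe_indicatorConst, hΦ]
      refine integral_eq_zero_of_ae ?_
      filter_upwards [hmem.coeFn_toLp, indicatorConstLp_coeFn (p := 1) (hs := hF) (hμs := hμ.ne)
        (c := c), measure_eq_zero_iff_ae_notMem.1 hnull] with ω h1 h2 h3
      rw [h1, h2]
      by_cases hωE : ω ∈ E
      · simp [show ω ∉ F from fun hωF => h3 ⟨hωE, hωF⟩]
      · simp [hωE]
    · intro f g hf hg _ h1 h2
      rw [map_add, h1, h2, add_zero]
    · exact isClosed_eq (Φ (hmem.toLp _)).continuous continuous_const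
  have h1 : hmem.toLp _ = 0 := Φ.map_eq_zero_iff.1 hzero
  have h2 : E.indicator (fun _ => u) =ᵐ[μ] 0 := by
    have := hmem.coeFn_toLp
    rw [h1] at this
    exact this.symm.trans (Lp.coeFn_zero _ _ _)
  refine h0 (measure_mono_null (fun ω hω => ?_) (ae_iff.1 h2))
  have : u ≠ 0 := fun hu0 => by simp [hu0] at hu
  simpa [hω] using this

theorem nontrivial_L1 [Nontrivial X] {E : Set Ω} (hE : MeasurableSet E) (h0 : μ E ≠ 0)
    (hμ : μ E ≠ ∞) : Nontrivial (Lp X 1 μ) := by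
  obtain ⟨x, hx⟩ := exists_ne (0 : X)
  refine ⟨indicatorL1 μ X E x, 0, fun h => ?_⟩
  rw [← norm_eq_zero, norm_indicatorL1 hE hμ] at h
  exact (mul_pos (ENNReal.toReal_pos h0 hμ) (norm_pos_iff.2 hx)).ne' h

end Semifinite

/-! ### The diameter two properties of `L_1(μ;X)` -/

section Transfer

variable {Ω : Type*} [MeasurableSpace Ω] {μ : Measure Ω}
  {X : Type*} [NormedAddCommGroup X] [NormedSpace ℝ X] [CompleteSpace X]
  {ι : Type}

theorem HasAlignedNorming.mono {E : Type*} [NormedAddCommGroup E] [NormedSpace ℝ E]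
    {R : Set ℝ} {t t' : ℝ} (h : HasAlignedNorming E ι R t') (ht : t ≤ t') :
    HasAlignedNorming E ι R t := fun φ hφ =>
  let ⟨f, hf, h⟩ := h φ hφ
  ⟨f, hf, fun i r hr => let ⟨x, hx, h1, h2⟩ := h i r hr; ⟨x, hx, h1, ht.trans h2⟩⟩

/-- For a fixed norming constant `r`, the loss in the norming constants is compensated by starting
from `(1 + r) / 2`, whose square is at least `r`. -/
theorem hasAlignedNorming_L1_singleton [Nontrivial X] [Countable ι] {r t : ℝ}
    (hr : r ∈ Ioo (0 : ℝ) 1) (ht : t ≤ 1) (hX : HasAlignedNorming X ι {(1 + r) / 2} t) :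
    HasAlignedNorming (Lp X 1 μ) ι {r} t := by
  refine hasAlignedNorming_L1 (countable_singleton r) ht ?_ fun _ => hX
  intro q hq
  obtain rfl : q = r := hq
  exact ⟨_, rfl, (1 + q) / 2, ⟨by linarith [hr.1], by linarith [hr.2]⟩, by linarith [hr.1],
    by linarith [hr.2], by nlinarith [sq_nonneg (q - 1)]⟩

theorem hasAlignedNorming_L1_Ioo [Nontrivial X] [Countable ι]
    (hX : HasAtoms μ → HasAlignedNorming X ι (Ioo 0 1) 1) :
    HasAlignedNorming (Lp X 1 μ) ι (Ioo 0 1) 1 := by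
  -- rational norming constants suffice, so that countably many pieces of `Ω` are needed
  have h : HasAlignedNorming (Lp X 1 μ) ι (Ioo 0 1 ∩ range ((↑) : ℚ → ℝ)) 1 := by
    refine hasAlignedNorming_L1 ((countable_range _).mono inter_subset_right) le_rfl ?_ hX
    rintro r ⟨hr, -⟩
    have : (1 + r) / 2 ∈ Ioo (0 : ℝ) 1 := ⟨by linarith [hr.1], by linarith [hr.2]⟩
    exact ⟨_, this, _, this, this.1.le, by linarith [hr.2], by nlinarith [sq_nonneg (r - 1)]⟩
  refine fun φ hφ => (h φ hφ).mono fun r hr => ?_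
  obtain ⟨q, hq1, hq2⟩ := exists_rat_btwn hr.2
  exact ⟨q, ⟨⟨hr.1.trans hq1, hq2⟩, q, rfl⟩, hq1.le⟩

variable {A : Set Ω}

theorem hasAlignedNorming_Ioo_iff [Nontrivial X] [Countable ι] (hA : IsMeasureAtom μ A)
    (hμ : μ A ≠ ∞) :
    HasAlignedNorming (Lp X 1 μ) ι (Ioo 0 1) 1 ↔ HasAlignedNorming X ι (Ioo 0 1) 1 :=
  ⟨hasAlignedNorming_of_L1 hA hμ le_rfl fun r hr => ⟨r, hr, hr.1, hr.1.le, le_rfl, by simp⟩,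
    fun h => hasAlignedNorming_L1_Ioo fun _ => h⟩

theorem hasAlignedNorming_one_iff [Nontrivial X] [Countable ι] (hA : IsMeasureAtom μ A)
    (hμ : μ A ≠ ∞) :
    (∀ r ∈ Ioo (0 : ℝ) 1, HasAlignedNorming (Lp X 1 μ) ι {r} 1) ↔
      ∀ r ∈ Ioo (0 : ℝ) 1, HasAlignedNorming X ι {r} 1 := by
  refine ⟨fun h r hr => hasAlignedNorming_of_L1 hA hμ le_rfl ?_ (h r hr),
    fun h r hr => hasAlignedNorming_L1_singleton hr le_rfl
      (h _ ⟨by linarith [hr.1], by linarith [hr.2]⟩)⟩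
  rintro _ rfl
  exact ⟨_, rfl, hr.1, hr.1.le, le_rfl, by simp⟩

theorem hasAlignedNorming_self_iff [Nontrivial X] [Countable ι] (hA : IsMeasureAtom μ A)
    (hμ : μ A ≠ ∞) :
    (∀ r ∈ Ioo (0 : ℝ) 1, HasAlignedNorming (Lp X 1 μ) ι {r} r) ↔
      ∀ r ∈ Ioo (0 : ℝ) 1, HasAlignedNorming X ι {r} r := by
  constructor
  · intro h r hr
    -- `r' = 1 / (2 - r)` solves `1 - r' = (1 - r) * r'`
    have h2 : 0 < 2 - r := by linarith [hr.2]
    have hmul : (2 - r)⁻¹ * (2 - r) = 1 := inv_mul_cancel₀ h2.ne'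
    have h0 : 0 < (2 - r)⁻¹ := inv_pos.2 h2
    have h1 : (2 - r)⁻¹ < 1 := inv_lt_one_of_one_lt₀ (by linarith [hr.2])
    have hle : r ≤ (2 - r)⁻¹ := by
      rw [← one_div, le_div_iff₀ h2]
      nlinarith [sq_nonneg (r - 1)]
    refine hasAlignedNorming_of_L1 hA hμ hr.2.le ?_ (h _ ⟨h0, h1⟩)
    rintro _ rfl
    exact ⟨_, rfl, h0, hr.1.le, hle, by linarith⟩
  · intro h r hr
    have hr' : (1 + r) / 2 ∈ Ioo (0 : ℝ) 1 := ⟨by linarith [hr.1], by linarith [hr.2]⟩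
    exact hasAlignedNorming_L1_singleton hr hr.2.le ((h _ hr').mono (by linarith [hr.2]))

end Transfer

theorem theorem6p12 {Ω : Type*} [MeasurableSpace Ω] (μ : Measure Ω)
    {X : Type*} [NormedAddCommGroup X] [NormedSpace ℝ X] [CompleteSpace X] [Nontrivial X]
    (h : (IsDecomposable μ ∧ TopologicalSpace.SeparableSpace (StrongDual ℝ X)) ∨
      (SigmaFinite μ ∧ HasRNPWithRespectTo (StrongDual ℝ X) μ) ∨
      DualOfL1IsLinfty X μ) :
    (μ ≠ 0 → IsAtomless μ → HasOneASD2PCard (Lp X 1 μ) ℵ₀) ∧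
    (HasAtoms μ →
      (HasSD2P (Lp X 1 μ) ↔ HasSD2P X) ∧
      (HasASD2P (Lp X 1 μ) ↔ HasASD2P X) ∧
      (HasOneASD2PCardLT (Lp X 1 μ) ℵ₀ ↔ HasOneASD2PCardLT X ℵ₀) ∧
      (HasSD2PCard (Lp X 1 μ) ℵ₀ ↔ HasSD2PCard X ℵ₀) ∧
      (HasOneASD2PCard (Lp X 1 μ) ℵ₀ ↔ HasOneASD2PCard X ℵ₀)) := by
  have hsemi : ∀ E, MeasurableSet E → μ E ≠ 0 → ∃ F ⊆ E, MeasurableSet F ∧ μ F ≠ 0 ∧ μ F ≠ ∞ := by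
    intro E hE h0
    rcases h with ⟨h, -⟩ | ⟨h, -⟩ | h
    · exact h.exists_subset hE h0
    · obtain ⟨F, hF, hFE, hF0, hFμ⟩ :=
        Measure.exists_subset_measure_lt_top hE (pos_iff_ne_zero.2 h0)
      exact ⟨F, hFE, hF, hF0.ne', hFμ.ne⟩
    · exact h.exists_subset hE h0
  constructor
  · intro hμ hna
    obtain ⟨F, -, hF, hF0, hFμ⟩ := hsemi univ .univ (Measure.measure_univ_ne_zero.2 hμ)
    have := nontrivial_L1 (X := X) hF hF0 hFμ
    exact hasOneASD2PCard_iff.2 (hasAlignedNorming_L1_Ioo fun hat => absurd hat hna)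
  · rintro ⟨A, hA⟩
    obtain ⟨F, hFA, hF, hF0, hFμ⟩ := hsemi A hA.1 hA.2.1
    have hμ : μ A ≠ ∞ := measure_congr (hA.ae_eq_of_subset hF hFA hF0) ▸ hFμ
    have := nontrivial_L1 (X := X) hA.1 hA.2.1 hμ
    refine ⟨?_, ?_, ?_, ?_, ?_⟩
    · rw [hasSD2P_iff, hasSD2P_iff]
      exact forall_congr' fun n => hasAlignedNorming_self_iff hA hμ
    · rw [hasASD2P_iff, hasASD2P_iff]
      exact forall_congr' fun n => hasAlignedNorming_one_iff hA hμ
    · rw [hasOneASD2PCardLT_iff, hasOneASD2PCardLT_iff]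
      exact forall_congr' fun n => hasAlignedNorming_Ioo_iff hA hμ
    · rw [hasSD2PCard_iff, hasSD2PCard_iff]
      exact hasAlignedNorming_self_iff hA hμ
    · rw [hasOneASD2PCard_iff, hasOneASD2PCard_iff]
      exact hasAlignedNorming_Ioo_iff hA hμ
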